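/- Let $N\ge 2$, $t_0\in\mathbb R$, $\mathbb 1=(1,\dots,1)$, and equip $\mathbb R^N$ with the maximum norm. Consider $$\dot x_i=F(X,x_i)+H_i(X),\qquad i=1,\dots,N,\quad t\ge t_0,\qquad X=(x_1,\dots,x_N),\tag{P}$$ with $F:\mathbb R^N\times\mathbb R\to\mathbb R$ and $H=(H_1,\dots,H_N):\mathbb R^N\to\mathbb R^N$; $\Phi^t$ denotes its flow, normalized by $\Phi^{t_0}=\mathrm{id}$. For a function $g=(g_1,\dots,g_p)$ on $\mathbb R^q$ let $\|g\|_B=\sup_{y\in B}\max_i|g_i(y)|\in[0,\infty]$, where $B=\{y\in\mathbb R^q:\max_{i,j}|y_i-y_j|\le 1\}$; $\|dg\|_B$ and $\|d^2g\|_B$ are the maxima of $\|\cdot\|_B$ over all first, respectively second, partial derivatives of the components. ($F$ is regarded as a function on $\mathbb R^{N+1}$.) A function $g$ on $\mathbb R^q$ is $\mathbb 1$-periodic if $g(y+\mathbb 1)=g(y)$ for all $y$, with $\mathbb 1=(1,\dots,1)\in\mathbb R^q$. Assume (H) $F$ is of class $C^2$ and $\mathbb 1$-periodic, $\max\{\|F\|_B,\|dF\|_B,\|d^2F\|_B\}<\infty$,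 and $\min_{s\in[0,1]}F(s\mathbb 1,s)>0$; (H$_*$) $\displaystyle\int_0^1\frac{\partial_{N+1}F(s\mathbb 1,s)}{F(s\mathbb 1,s)}\,ds<0$. Then there is $D_*>0$ such that for every $D\in(0,D_*]$ there are $r>0$ and an open set $$C_r=\{X\in\mathbb R^N:\ \exists\,\nu\in\mathbb R,\ \max_i|x_i-\nu|<\Delta_r(\nu)\},$$ where $\Delta_r:\mathbb R\to(0,D]$ is $C^1$ and $1$-periodic, with the following properties. (a) For every $H$ of class $C^1$ with $\|H\|_B<r$: for every $X\in C_r$ the orbit $\Phi^t(X)$ exists for all $t\ge t_0$ and stays in $C_r$, $\min_i\inf_{t\ge t_0}\frac{d}{dt}\Phi^t_i(X)>0$, and $|\Phi^t_i(X)-\Phi^t_j(X)|<2D$ for all $i,j$ and all $t\ge t_0$. (b) For every $\mathbb 1$-periodic $H$ of class $C^1$ with $\max\{\|H\|_B,\|dH\|_B\}<r$ there are a $C^1$ submanifold $\mathcal W_{stab}\subset C_r$ of $\mathbb R^N$ of dimension $N-1$, a number $\rho>0$ and a $C^1$, $\frac1\rho$-periodic function $\Psi:\mathbb R\to\mathbb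 R^N$ such that $t\mapsto\rho t\mathbb 1+\Psi(t)$ is a solution of (P) on $[t_0,\infty)$ whose initial point $X_*=\rho t_0\mathbb 1+\Psi(t_0)$ lies in $\mathcal W_{stab}$, and such that for some $\beta>0$ and $K>0$ $$\|\Phi^t(X)-\rho t\mathbb 1-\Psi(t)\|<K e^{-\beta(t-t_0)}\qquad\text{for all }X\in\mathcal W_{stab},\ t\ge t_0 .$$ Moreover the phase-locked orbit is a stable limit cycle (it is closed modulo $\mathbb Z\mathbb 1$): with $\Gamma=\{\rho t\mathbb 1+\Psi(t):t\in\mathbb R\}$, there is $\delta>0$ such that for every $X$ with $\operatorname{dist}(X,\Gamma)<\delta$ the orbit $\Phi^t(X)$ exists for all $t\ge t_0$ and $\operatorname{dist}(\Phi^t(X),\Gamma)\to0$ as $t\to\infty$; and for every $\varepsilon>0$ there is $\delta>0$ such that $\operatorname{dist}(X,\Gamma)<\delta$ implies $\operatorname{dist}(\Phi^t(X),\Gamma)<\varepsilon$ for all $t\ge t_0$. -/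

import Mathlib

open scoped ENNReal Topology

noncomputable section

namespace MeanField

/-- The strip `B = {y ∈ ℝ^q : |y_i - y_j| ≤ 1 for all i, j}` around the diagonal. -/
def strip (q : ℕ) : Set (Fin q → ℝ) := {y | ∀ i j, |y i - y j| ≤ 1}

/-- `‖g‖_B = sup_{y ∈ B} |g y|` for a scalar function, with values in `[0, ∞]`. -/
def stripNorm {q : ℕ} (g : (Fin q → ℝ) → ℝ) : ℝ≥0∞ := ⨆ y ∈ strip q, ‖g y‖ₑ

/-- The partial derivative `∂_j g`. -/
def partialD {q : ℕ} (j : Fin q) (g : (Fin q → ℝ) → ℝ) : (Fin q → ℝ) → ℝ :=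
  fun y => fderiv ℝ g y (Pi.single j 1)

/-- `‖dg‖_B` for a scalar function. -/
def stripNormD {q : ℕ} (g : (Fin q → ℝ) → ℝ) : ℝ≥0∞ := ⨆ j, stripNorm (partialD j g)

/-- `‖d²g‖_B` for a scalar function. -/
def stripNormD2 {q : ℕ} (g : (Fin q → ℝ) → ℝ) : ℝ≥0∞ :=
  ⨆ j, ⨆ k, stripNorm (partialD k (partialD j g))

/-- `‖g‖_B` for a vector-valued function. -/
def stripNormVec {q p : ℕ} (g : (Fin q → ℝ) → (Fin p → ℝ)) : ℝ≥0∞ :=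
  ⨆ i, stripNorm (fun y => g y i)

/-- `‖dg‖_B` for a vector-valued function. -/
def stripNormDVec {q p : ℕ} (g : (Fin q → ℝ) → (Fin p → ℝ)) : ℝ≥0∞ :=
  ⨆ i, stripNormD (fun y => g y i)

/-- `F : ℝ^N × ℝ → ℝ` regarded as a function on `ℝ^{N+1}`; the last variable is `z`. -/
def joint {N : ℕ} (F : (Fin N → ℝ) → ℝ → ℝ) : (Fin (N + 1) → ℝ) → ℝ :=
  fun y => F (Fin.init y) (y (Fin.last N))

/-- The point `s𝟙` of the diagonal. -/
def diag (N : ℕ) (s : ℝ) : Fin N → ℝ := fun _ => s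

/-- Hypothesis (H). -/
structure HypH {N : ℕ} (F : (Fin N → ℝ) → ℝ → ℝ) : Prop where
  contDiff : ContDiff ℝ 2 (joint F)
  bounded : max (stripNorm (joint F)) (max (stripNormD (joint F)) (stripNormD2 (joint F))) < ∞
  periodic : Function.Periodic (joint F) 1
  pos : ∀ s ∈ Set.Icc (0 : ℝ) 1, 0 < F (diag N s) s

/-- Hypothesis (H_*); the numerator is `∂_{N+1} F(s𝟙, s)`. -/
def HypHStar {N : ℕ} (F : (Fin N → ℝ) → ℝ → ℝ) : Prop :=
  ∫ s in (0 : ℝ)..1, deriv (fun z => F (diag N s) z) s / F (diag N s) s < 0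

/-- The vector field `X ↦ (F(X, x_i) + H_i(X))_i` of the perturbed mean-field system. -/
def field {N : ℕ} (F : (Fin N → ℝ) → ℝ → ℝ) (H : (Fin N → ℝ) → (Fin N → ℝ)) :
    (Fin N → ℝ) → (Fin N → ℝ) :=
  fun X i => F X (X i) + H X i

/-- `x` solves `ẋ = V(x)` on `[t₀, ∞)` (one-sided derivative at `t₀`). For a `C¹` field `V` and
`x t₀ = X` this says `x t = Φ^t(X)` for all `t ≥ t₀`, where `Φ` is the flow of `V` with
`Φ^{t₀} = id`. -/
def IsForwardSolution {N : ℕ} (V : (Fin N → ℝ) → (Fin N → ℝ)) (t₀ : ℝ) (x : ℝ → Fin N → ℝ) :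
    Prop :=
  IsIntegralCurveOn x (fun _ => V) (Set.Ici t₀)

/-- The tube `{X : ∃ ν, max_i |x_i - ν| < Δ(ν)}`. -/
def tube (N : ℕ) (Δ : ℝ → ℝ) : Set (Fin N → ℝ) := {X | ∃ ν : ℝ, ∀ i, |X i - ν| < Δ ν}

/-- `C` is a synchronization region of `F` for the parameters `D` and `r`: an open tube whose
width is a `C¹`, `1`-periodic function with values in `(0, D]` such that, for every `C¹`
perturbation `H` with `‖H‖_B < r`, the forward flow exists on `C`, leaves `C` positively invariant,
and all orbits in `C` have velocities bounded below by a positive constant and mutual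
distances less than `2D`. -/
structure IsSyncRegion {N : ℕ} (F : (Fin N → ℝ) → ℝ → ℝ) (t₀ D r : ℝ) (C : Set (Fin N → ℝ)) :
    Prop where
  isOpen : IsOpen C
  eq_tube : ∃ Δ : ℝ → ℝ, ContDiff ℝ 1 Δ ∧ Function.Periodic Δ 1 ∧
    (∀ s, 0 < Δ s ∧ Δ s ≤ D) ∧ C = tube N Δ
  existence : ∀ H : (Fin N → ℝ) → (Fin N → ℝ), ContDiff ℝ 1 H →
    stripNormVec H < ENNReal.ofReal r →
    ∀ X ∈ C, ∃ x : ℝ → Fin N → ℝ, x t₀ = X ∧ IsForwardSolution (field F H) t₀ x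
  synchronization : ∀ H : (Fin N → ℝ) → (Fin N → ℝ), ContDiff ℝ 1 H →
    stripNormVec H < ENNReal.ofReal r →
    ∀ x : ℝ → Fin N → ℝ, IsForwardSolution (field F H) t₀ x → x t₀ ∈ C →
      (∀ t, t₀ ≤ t → x t ∈ C) ∧
      (∃ c > 0, ∀ t, t₀ ≤ t → ∀ i, c ≤ field F H (x t) i) ∧
      (∀ t, t₀ ≤ t → ∀ i j, |x t i - x t j| < 2 * D)

/-- `W` is an (embedded) `C¹` submanifold of `ℝ^n` of dimension `k`: near each of its points it is
the zero set of a `C¹` submersion to `ℝ^{n-k}`. -/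
def IsC1Submanifold {n : ℕ} (k : ℕ) (W : Set (Fin n → ℝ)) : Prop :=
  ∃ c : ℕ, k + c = n ∧ ∀ p ∈ W, ∃ U : Set (Fin n → ℝ), IsOpen U ∧ p ∈ U ∧
    ∃ g : (Fin n → ℝ) → (Fin c → ℝ), ContDiffOn ℝ 1 g U ∧
      (∀ y ∈ U, Function.Surjective (fderiv ℝ g y)) ∧ W ∩ U = {y ∈ U | g y = 0}

/-- The curve `t ↦ ρ t 𝟙 + Ψ(t)`. -/
def lockedOrbit {N : ℕ} (ρ : ℝ) (Ψ : ℝ → Fin N → ℝ) : ℝ → Fin N → ℝ :=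
  fun t => diag N (ρ * t) + Ψ t

/-- Asymptotic orbital stability of a set `Γ` under the forward flow of `V`: solutions starting
near `Γ` exist for all future times and converge to `Γ`, and they stay as near to `Γ` as desired if
they start near enough. -/
def IsOrbitallyAsymptoticallyStable {N : ℕ} (V : (Fin N → ℝ) → (Fin N → ℝ)) (t₀ : ℝ)
    (Γ : Set (Fin N → ℝ)) : Prop :=
  (∃ δ > 0,
    (∀ X : Fin N → ℝ, Metric.infDist X Γ < δ →
      ∃ x : ℝ → Fin N → ℝ, x t₀ = X ∧ IsForwardSolution V t₀ x) ∧
    (∀ x : ℝ → Fin N → ℝ, IsForwardSolution V t₀ x → Metric.infDist (x t₀) Γ < δ →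
      Filter.Tendsto (fun t => Metric.infDist (x t) Γ) Filter.atTop (𝓝 0))) ∧
  (∀ ε > 0, ∃ δ > 0, ∀ x : ℝ → Fin N → ℝ, IsForwardSolution V t₀ x →
    Metric.infDist (x t₀) Γ < δ → ∀ t, t₀ ≤ t → Metric.infDist (x t) Γ < ε)

end MeanField

end

/-! On the diagonal the unperturbed system moves with speed `F(s𝟙, s) > 0`. Across it, compare an
oscillator with a test particle `ν' = F(X, ν)` placed in the same mean field: to first order `x_i -
ν` is multiplied by `∂_{N+1}F`, whatever the derivative of `F` in `X` may be. Per unit of `s` this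
is the exponent `b(s) = ∂_{N+1}F / F`, whose mean is `-lam < 0` by (H_*). The periodic solution `w`
of `w' = w (b + lam)` absorbs its oscillation: distances measured in units of `w` shrink at the
constant rate `lam`, which leaves room for nonlinear errors and for `H`.

For (a), a multiple `Δ` of `w` is the width of the tube. The test particle is its centre, and on the
boundary the inward rate beats the errors (`exists_solution_in_tube`, `isSyncRegion_tube`). Only the
size of `H` enters, not its derivative.

For (b), one coordinate `o` serves as time, so that the field becomes `V_i / V_o`. For two points
with the same coordinate `o`, the first-order effect of the mean field is the same in numerator and
denominator and cancels; what is left is `b (X_i - X'_i)` plus small errors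
(`abs_div_sub_div_sub_le`, `field_contraction`). After a cutoff away from the diagonal the field
satisfies `ContractingField`, and its section flow contracts the sections of the tube
(`norm_sub_diag_le`, `norm_sub_le`). Banach's theorem for the return map gives the locked orbit
(`exists_fixedPoint`), and the same contraction gives orbital stability.

The stable fibre is a piece of a level set of the asymptotic phase, the limit of the arrival time at
the `n`-th section minus `n` periods. Return times converge geometrically, so the phase is `C¹`
(`exists_phase_ball`); it decreases at unit rate along the locked orbit, so its zero set is a
hypersurface there (`exists_isC1Submanifold`), and equal phase means exponential attraction
(`exists_exp_attraction`). Since the cut-off field equals the original one on the invariant tube,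
everything transfers back. -/

/-! ### Ordinary differential equations: global solutions, uniqueness, `C¹` flows. -/

open Set Metric in
theorem exists_isIntegralCurve_of_contDiff_of_bounded {E : Type*} [NormedAddCommGroup E]
    [NormedSpace ℝ E] [FiniteDimensional ℝ E] {V : E → E} (hV : ContDiff ℝ 1 V) {M : ℝ}
    (hM : ∀ x, ‖V x‖ ≤ M) (x : E) :
    ∃ γ : ℝ → E, γ 0 = x ∧ ∀ t, HasDerivAt γ (V (γ t)) t := by
  have := FiniteDimensional.complete ℝ E
  have hM0 : 0 ≤ M := (norm_nonneg _).trans (hM x)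
  -- Regarding `E` as a manifold over itself reduces a global curve to curves on every interval
  -- `(-a, a)`.
  have key := exists_isMIntegralCurve_iff_exists_isMIntegralCurveOn_Ioo (I := modelWithCornersSelf ℝ E)
    (M := E) (v := fun y => (V y : E)) ((contMDiff_vectorSpace_iff_contDiff).2 hV) x
  obtain ⟨γ, h0, hγ⟩ := key.2 (fun a => by
    set b : ℝ := max a 0
    have hb : 0 ≤ b := le_max_right _ _
    obtain ⟨K, hK⟩ := (hV.contDiffOn (s := closedBall x (M * b))).exists_lipschitzOnWith one_ne_zero
      (convex_closedBall _ _) (isCompact_closedBall _ _)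
    -- At speed at most `M` the curve stays within `M * b` of `x` during `[-b, b]`, so the time of
    -- existence is not cut down.
    have hPL : IsPicardLindelof (fun _ => V) (tmin := -b) (tmax := b) ⟨0, by simp [hb], hb⟩ x
        ⟨M * b, by positivity⟩ 0 ⟨M, hM0⟩ K :=
      IsPicardLindelof.of_time_independent (fun y _ => hM y) hK (by
        change M * max (b - 0) (0 - -b) ≤ M * b - 0
        simp)
    obtain ⟨γ, h0, hγ⟩ := hPL.exists_eq_forall_mem_Icc_hasDerivWithinAt₀
    refine ⟨γ, h0, fun t ht => ?_⟩
    have ht' : t ∈ Ioo (-b) b :=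
      ⟨lt_of_le_of_lt (neg_le_neg (le_max_left _ _)) ht.1, ht.2.trans_le (le_max_left _ _)⟩
    exact ((hγ t ⟨ht'.1.le, ht'.2.le⟩).hasDerivAt
      (Icc_mem_nhds ht'.1 ht'.2)).hasFDerivAt.hasMFDerivAt.hasMFDerivWithinAt)
  refine ⟨γ, h0, fun t => ?_⟩
  have h : HasFDerivAt γ ((1 : ℝ →L[ℝ] ℝ).smulRight (V (γ t)) : ℝ →L[ℝ] E) t := (hγ t).hasFDerivAt
  exact h.hasDerivAt.congr_deriv (by simp)

open Set Metric in
/-- Forward uniqueness for a `C¹` field. -/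
theorem eqOn_Ici_of_isIntegralCurveOn {E : Type*} [NormedAddCommGroup E]
    [NormedSpace ℝ E] [FiniteDimensional ℝ E] {V : E → E} (hV : ContDiff ℝ 1 V) {t₀ : ℝ}
    {x y : ℝ → E} (hx : IsIntegralCurveOn x (fun _ => V) (Ici t₀))
    (hy : IsIntegralCurveOn y (fun _ => V) (Ici t₀)) (h : x t₀ = y t₀) : EqOn x y (Ici t₀) := by
  intro t ht
  have hxc : ContinuousOn x (Icc t₀ t) := hx.continuousOn.mono Icc_subset_Ici_self
  have hyc : ContinuousOn y (Icc t₀ t) := hy.continuousOn.mono Icc_subset_Ici_self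
  obtain ⟨R, hR⟩ := ((isCompact_Icc.image_of_continuousOn hxc).union
    (isCompact_Icc.image_of_continuousOn hyc)).isBounded.subset_closedBall 0
  obtain ⟨K, hK⟩ := (hV.contDiffOn (s := closedBall 0 R)).exists_lipschitzOnWith one_ne_zero
      (convex_closedBall _ _) (isCompact_closedBall _ _)
  exact ODE_solution_unique_of_mem_Icc_right (v := fun _ => V) (s := fun _ => closedBall 0 R)
    (fun _ _ => hK) hxc
    (fun s hs => (hx s hs.1).mono (Ici_subset_Ici.2 hs.1))
    (fun s hs => hR (Or.inl ⟨s, ⟨hs.1, hs.2.le⟩, rfl⟩)) hyc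
    (fun s hs => (hy s hs.1).mono (Ici_subset_Ici.2 hs.1))
    (fun s hs => hR (Or.inr ⟨s, ⟨hs.1, hs.2.le⟩, rfl⟩)) h ⟨ht, le_rfl⟩

-- Uniform continuity at the points of a compact set; the second point `y` is free to leave `s`,
-- which is what perturbing a compact orbit segment requires.
open Set Metric in
theorem IsCompact.exists_delta_norm_sub_le {E F : Type*} [NormedAddCommGroup E]
    [NormedAddCommGroup F] {s : Set E} (hs : IsCompact s) {f : E → F} (hf : Continuous f)
    {ε : ℝ} (hε : 0 < ε) : ∃ δ > 0, ∀ x ∈ s, ∀ y, ‖y - x‖ < δ → ‖f y - f x‖ < ε := by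
  have h := hs.uniformContinuousAt_of_continuousAt f (fun a _ => hf.continuousAt)
    (Metric.dist_mem_uniformity hε)
  obtain ⟨δ, hδ, H⟩ := Metric.mem_uniformity_dist.1 h
  refine ⟨δ, hδ, fun x hx y hy => ?_⟩
  have : dist (f x) (f y) < ε := @H x y (by rwa [dist_comm, dist_eq_norm]) hx
  rwa [dist_comm, dist_eq_norm] at this

-- Grönwall on the unit interval with rate `1/2`: since `exp (1/2) ≤ 2`, initial error and forcing
-- are both at most doubled.
open Set in
theorem norm_le_of_norm_deriv_le_half {F : Type*} [NormedAddCommGroup F] [NormedSpace ℝ F]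
    {f f' : ℝ → F} {δ ε : ℝ} (hδ : 0 ≤ δ) (hε : 0 ≤ ε)
    (hf : ∀ t ∈ Icc (0 : ℝ) 1, HasDerivWithinAt f (f' t) (Icc 0 1) t) (h0 : ‖f 0‖ ≤ δ)
    (hb : ∀ t ∈ Icc (0 : ℝ) 1, ‖f' t‖ ≤ 1 / 2 * ‖f t‖ + ε) :
    ∀ t ∈ Icc (0 : ℝ) 1, ‖f t‖ ≤ 2 * (δ + ε) := by
  intro t ht
  have h := norm_le_gronwallBound_of_norm_deriv_right_le (K := 1 / 2) (ε := ε)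
    (fun s hs => (hf s hs).continuousWithinAt)
    (fun s hs => ((hf s ⟨hs.1, hs.2.le⟩).mono_of_mem_nhdsWithin (Icc_mem_nhdsGE_of_mem hs))) h0
    (fun s hs => hb s ⟨hs.1, hs.2.le⟩) t ht
  refine h.trans ?_
  rw [gronwallBound_of_K_ne_0 (by norm_num)]
  have h1 : Real.exp (1 / 2 * (t - 0)) ≤ 2 := by
    have h2 : Real.exp (1 / 2 * (t - 0)) ≤ Real.exp (1 / 2) :=
      Real.exp_le_exp.2 (by linarith [ht.2])
    have h3 : Real.exp (1 / 2) * Real.exp (1 / 2) = Real.exp 1 := by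
      rw [← Real.exp_add]; norm_num
    nlinarith [Real.exp_one_lt_d9, Real.exp_pos (1 / 2)]
  have h4 : δ * Real.exp (1 / 2 * (t - 0)) ≤ δ * 2 := mul_le_mul_of_nonneg_left h1 hδ
  have h5 : ε / (1 / 2) * (Real.exp (1 / 2 * (t - 0)) - 1) ≤ ε / (1 / 2) * 1 :=
    mul_le_mul_of_nonneg_left (by linarith) (by positivity)
  linarith

open Set Metric in
/-- `C¹` dependence on initial values of the time-one map of a field with small derivative. -/
theorem contDiffOn_time_one_of_norm_fderiv_le_half {E : Type*} [NormedAddCommGroup E]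
    [NormedSpace ℝ E] [CompleteSpace E] {V : E → E} (hV : ContDiff ℝ 1 V) {U S : Set E}
    (hU : IsOpen U) (hS : Convex ℝ S) (hVS : ∀ y ∈ S, ‖fderiv ℝ V y‖ ≤ 1 / 2)
    {φ : E → ℝ → E} (h0 : ∀ x ∈ U, φ x 0 = x)
    (hφ : ∀ x ∈ U, ∀ t ∈ Icc (0 : ℝ) 1, HasDerivWithinAt (φ x) (V (φ x t)) (Icc 0 1) t)
    (hφS : ∀ x ∈ U, ∀ t ∈ Icc (0 : ℝ) 1, φ x t ∈ S) :
    ContDiffOn ℝ 1 (fun x => φ x 1) U := by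
  have hdiff : Differentiable ℝ V := hV.differentiable one_ne_zero
  have hcont : Continuous (fderiv ℝ V) := hV.continuous_fderiv one_ne_zero
  have hφc : ∀ x ∈ U, ContinuousOn (φ x) (Icc 0 1) := fun x hx t ht =>
    (hφ x hx t ht).continuousWithinAt
  have hVlip : ∀ y ∈ S, ∀ z ∈ S, ‖V z - V y‖ ≤ 1 / 2 * ‖z - y‖ := fun y hy z hz =>
    hS.norm_image_sub_le_of_norm_fderiv_le (fun _ _ => hdiff _) hVS hy hz
  have hlip : ∀ x ∈ U, ∀ y ∈ U, ∀ t ∈ Icc (0 : ℝ) 1, ‖φ y t - φ x t‖ ≤ 2 * ‖y - x‖ := by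
    intro x hx y hy t ht
    have := norm_le_of_norm_deriv_le_half (f := fun t => φ y t - φ x t) (norm_nonneg (y - x))
      le_rfl (fun t ht => (hφ y hy t ht).sub (hφ x hx t ht)) (by simp [h0 x hx, h0 y hy])
      (fun t ht => by simpa using hVlip _ (hφS x hx t ht) _ (hφS y hy t ht)) t ht
    simpa using this
  -- `J` solves the variational equation along the orbit of `x`. In the unit ball around the
  -- identity `‖J‖ ≤ 2`, so its speed is at most `1/2 * 2 = 1` and Picard–Lindelöf reaches time one.
  have hJ : ∀ x, ∃ J : ℝ → E →L[ℝ] E, x ∈ U → J 0 = ContinuousLinearMap.id ℝ E ∧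
      ∀ t ∈ Icc (0 : ℝ) 1,
        HasDerivWithinAt J ((fderiv ℝ V (φ x t)).comp (J t)) (Icc 0 1) t := by
    intro x
    by_cases hx : x ∈ U
    swap
    · exact ⟨0, fun h => absurd h hx⟩
    have hPL : IsPicardLindelof (fun t (J : E →L[ℝ] E) => (fderiv ℝ V (φ x t)).comp J)
        (tmin := 0) (tmax := 1) ⟨0, by simp⟩ (ContinuousLinearMap.id ℝ E) 1 0 1 1 := by
      refine ⟨fun t ht => LipschitzOnWith.of_dist_le_mul fun J _ J' _ => ?_, fun J _ => ?_,
        fun t ht J hJ => ?_, by norm_num⟩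
      · rw [dist_eq_norm, dist_eq_norm, ← ContinuousLinearMap.comp_sub]
        refine (ContinuousLinearMap.opNorm_comp_le _ _).trans ?_
        have := hVS _ (hφS x hx t ht)
        gcongr
        simpa using this.trans (by norm_num)
      · exact (hcont.comp_continuousOn (hφc x hx)).clm_comp continuousOn_const
      · refine (ContinuousLinearMap.opNorm_comp_le _ _).trans ?_
        have h1 := hVS _ (hφS x hx t ht)
        have h2 : ‖J‖ ≤ 2 := by
          have h3 : ‖J - ContinuousLinearMap.id ℝ E‖ ≤ 1 := by
            simpa [dist_eq_norm] using hJ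
          have h4 := ContinuousLinearMap.norm_id_le (𝕜 := ℝ) (E := E)
          have h5 := norm_add_le (J - ContinuousLinearMap.id ℝ E) (ContinuousLinearMap.id ℝ E)
          rw [sub_add_cancel] at h5
          linarith
        calc _ ≤ 1 / 2 * (2 : ℝ) := by gcongr
          _ = _ := by simp
    obtain ⟨J, hJ0, hJ⟩ := hPL.exists_eq_forall_mem_Icc_hasDerivWithinAt₀
    exact ⟨J, fun _ => ⟨hJ0, hJ⟩⟩
  choose J hJ using hJ
  have hJb : ∀ x ∈ U, ∀ t ∈ Icc (0 : ℝ) 1, ‖J x t‖ ≤ 2 := by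
    intro x hx t ht
    have := norm_le_of_norm_deriv_le_half (f := J x) zero_le_one le_rfl (hJ x hx).2
      (by rw [(hJ x hx).1]; exact ContinuousLinearMap.norm_id_le)
      (fun t ht => by
        refine (ContinuousLinearMap.opNorm_comp_le _ _).trans ?_
        have h1 := hVS _ (hφS x hx t ht)
        rw [add_zero]
        gcongr) t ht
    linarith
  have hunif : ∀ x ∈ U, ∀ ε > 0, ∃ δ > 0, ∀ t ∈ Icc (0 : ℝ) 1, ∀ y, ‖y - φ x t‖ < δ →
      ‖fderiv ℝ V y - fderiv ℝ V (φ x t)‖ < ε := by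
    intro x hx ε hε
    obtain ⟨δ, hδ, H⟩ := (isCompact_Icc.image_of_continuousOn
      (hφc x hx)).exists_delta_norm_sub_le hcont hε
    exact ⟨δ, hδ, fun t ht y hy => H _ ⟨t, ht, rfl⟩ y hy⟩
  have hder : ∀ x ∈ U, HasFDerivAt (fun x => φ x 1) (J x 1) x := by
    intro x hx
    rw [hasFDerivAt_iff_isLittleO]
    refine Asymptotics.IsLittleO.of_bound fun c hc => ?_
    obtain ⟨δ, hδ, H⟩ := hunif x hx (c / 4) (by positivity)
    filter_upwards [hU.mem_nhds hx, ball_mem_nhds x (show 0 < δ / 2 by positivity)] with y hy hyd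
    rw [mem_ball, dist_eq_norm] at hyd
    -- The remainder of the linearization solves the variational equation up to the Taylor error of
    -- `V`, which is at most `c / 4 * 2‖y - x‖`.
    have := norm_le_of_norm_deriv_le_half (f := fun t => φ y t - φ x t - J x t (y - x)) le_rfl
      (show 0 ≤ c / 2 * ‖y - x‖ by positivity)
      (fun t ht => ((hφ y hy t ht).sub (hφ x hx t ht)).sub
        (((hJ x hx).2 t ht).clm_apply (hasDerivWithinAt_const t _ (y - x))))
      (by simp [h0 x hx, h0 y hy, (hJ x hx).1])
      (fun t ht => by
        have h1 : ‖φ y t - φ x t‖ < δ := (hlip x hx y hy t ht).trans_lt (by linarith)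
        have h2 := (convex_ball (φ x t) δ).norm_image_sub_le_of_norm_fderiv_le'
          (f := V) (φ := fderiv ℝ V (φ x t)) (C := c / 4) (𝕜 := ℝ) (fun _ _ => hdiff _)
          (fun z hz => (H t ht z (by rwa [mem_ball, dist_eq_norm] at hz)).le)
          (mem_ball_self hδ) (show φ y t ∈ ball (φ x t) δ by rwa [mem_ball, dist_eq_norm])
        have h3 : V (φ y t) - V (φ x t) - ((fderiv ℝ V (φ x t)).comp (J x t) (y - x) + J x t 0)
            = (V (φ y t) - V (φ x t) - fderiv ℝ V (φ x t) (φ y t - φ x t)) +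
              fderiv ℝ V (φ x t) (φ y t - φ x t - J x t (y - x)) := by
          simp only [map_sub, map_zero, ContinuousLinearMap.comp_apply]; abel
        rw [h3]
        refine (norm_add_le _ _).trans ?_
        have h4 := (fderiv ℝ V (φ x t)).le_of_opNorm_le (hVS _ (hφS x hx t ht))
          (φ y t - φ x t - J x t (y - x))
        have h5 := hlip x hx y hy t ht
        nlinarith) 1 (by simp)
    calc _ ≤ _ := this
      _ = c * ‖y - x‖ := by ring
  intro x hx
  refine ContDiffAt.contDiffWithinAt (contDiffAt_one_iff.2 ⟨fun x => J x 1, U, hU.mem_nhds hx,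
    fun y hy => ContinuousAt.continuousWithinAt ?_, hder⟩)
  rw [Metric.continuousAt_iff]
  intro ε hε
  obtain ⟨δ, hδ, H⟩ := hunif y hy (ε / 8) (by positivity)
  obtain ⟨δ', hδ', hU'⟩ := Metric.isOpen_iff.1 hU y hy
  refine ⟨min (δ / 2) δ', by positivity, fun {z} hz => ?_⟩
  have hzU : z ∈ U := hU' (hz.trans_le (min_le_right _ _))
  have hzd : ‖z - y‖ < δ / 2 := by
    rw [← dist_eq_norm]; exact hz.trans_le (min_le_left _ _)
  rw [dist_eq_norm]
  have := norm_le_of_norm_deriv_le_half (f := fun t => J z t - J y t) le_rfl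
    (show 0 ≤ ε / 4 by positivity)
    (fun t ht => ((hJ z hzU).2 t ht).sub ((hJ y hy).2 t ht))
    (by simp [(hJ z hzU).1, (hJ y hy).1])
    (fun t ht => by
      have h1 : ‖φ z t - φ y t‖ < δ := (hlip y hy z hzU t ht).trans_lt (by linarith)
      have h3 : (fderiv ℝ V (φ z t)).comp (J z t) - (fderiv ℝ V (φ y t)).comp (J y t)
          = (fderiv ℝ V (φ z t)).comp (J z t - J y t) +
            (fderiv ℝ V (φ z t) - fderiv ℝ V (φ y t)).comp (J y t) := by
        rw [ContinuousLinearMap.comp_sub, ContinuousLinearMap.sub_comp]; abel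
      rw [h3]
      refine (norm_add_le _ _).trans (add_le_add ?_ ?_)
      · refine (ContinuousLinearMap.opNorm_comp_le _ _).trans ?_
        have := hVS _ (hφS z hzU t ht)
        gcongr
      · refine (ContinuousLinearMap.opNorm_comp_le _ _).trans ?_
        have h6 := H t ht _ h1
        have h7 := hJb y hy t ht
        calc _ ≤ (ε / 8) * 2 := by gcongr
          _ = ε / 4 := by ring) 1 (by simp)
  linarith

theorem lipschitzWith_of_norm_fderiv_le' {E : Type*} [NormedAddCommGroup E]
    [NormedSpace ℝ E] {K : E → E} (hK : ContDiff ℝ 1 K) {L : ℝ} (hL : ∀ x, ‖fderiv ℝ K x‖ ≤ L) :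
    LipschitzWith L.toNNReal K :=
  lipschitzWith_of_nnnorm_fderiv_le (hK.differentiable one_ne_zero) (fun x => by
    rw [← NNReal.coe_le_coe, coe_nnnorm]; exact (hL x).trans (Real.le_coe_toNNReal L))

open Set Metric in
/-- The global flow of a bounded `C¹` field with bounded derivative; it is jointly `C¹`. -/
theorem exists_contDiff_flow {E : Type*} [NormedAddCommGroup E]
    [NormedSpace ℝ E] [FiniteDimensional ℝ E] {K : E → E} (hK : ContDiff ℝ 1 K) {M L : ℝ}
    (hM : ∀ x, ‖K x‖ ≤ M) (hL : ∀ x, ‖fderiv ℝ K x‖ ≤ L) :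
    ∃ φ : ℝ → E → E, (∀ x, φ 0 x = x) ∧
      (∀ t x, HasDerivAt (fun s => φ s x) (K (φ t x)) t) ∧
      ContDiff ℝ 1 (fun p : ℝ × E => φ p.1 p.2) := by
  have := FiniteDimensional.complete ℝ E
  have hM0 : 0 ≤ M := (norm_nonneg _).trans (hM 0)
  have hL0 : 0 ≤ L := (norm_nonneg _).trans (hL 0)
  choose γ h0 hγ using exists_isIntegralCurve_of_contDiff_of_bounded hK hM
  have hadd : ∀ s t x, γ x (s + t) = γ (γ x t) s := by
    intro s t x
    refine congrFun (ODE_solution_unique_univ (v := fun _ => K) (s := fun _ => univ) (t₀ := 0)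
      (f := fun s => γ x (s + t)) (g := γ (γ x t))
      (fun _ => (lipschitzWith_of_norm_fderiv_le' hK hL).lipschitzOnWith)
      (fun s => ⟨(hγ x (s + t)).comp_add_const s t, trivial⟩)
      (fun s => ⟨hγ _ s, trivial⟩) (by simp [h0])) s
  refine ⟨fun t x => γ x t, h0, fun t x => hγ x t, ?_⟩
  -- Rescaled time is made part of the initial value: the time-one map of `(τ, x) ↦ (0, hτ K x)` is
  -- `(τ, flow of x at hτ)`. For `|τ| < 2` the derivative of this field is at most `h (2L + M)`, so
  -- dependence on initial values yields joint smoothness in time and space.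
  obtain ⟨h, hh, hhs⟩ : ∃ h > 0, h * (2 * L + M) ≤ 1 / 2 := by
    refine ⟨1 / (2 * (2 * L + M + 1)), by positivity, ?_⟩
    rw [div_mul_eq_mul_div, div_le_div_iff₀ (by positivity) (by norm_num)]
    linarith
  have hsmall : ContDiffOn ℝ 1 (fun p : ℝ × E => γ p.2 (h * p.1)) {p | |p.1| < 2} := by
    have hS : {p : ℝ × E | |p.1| < 2} = ball 0 2 ×ˢ univ := by ext p; simp
    have hV : ContDiff ℝ 1 (fun p : ℝ × E => ((0 : ℝ), (h * p.1) • K p.2)) := by fun_prop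
    have hfd : ∀ p : ℝ × E, |p.1| < 2 →
        ‖fderiv ℝ (fun p : ℝ × E => ((0 : ℝ), (h * p.1) • K p.2)) p‖ ≤ 1 / 2 := by
      intro p hp
      have h1 : HasFDerivAt (fun p : ℝ × E => h * p.1) (h • ContinuousLinearMap.fst ℝ ℝ E) p :=
        hasFDerivAt_fst.const_mul h
      have h2 : HasFDerivAt (fun p : ℝ × E => K p.2)
          ((fderiv ℝ K p.2).comp (ContinuousLinearMap.snd ℝ ℝ E)) p :=
        ((hK.differentiable one_ne_zero) p.2).hasFDerivAt.comp p hasFDerivAt_snd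
      have h3 : HasFDerivAt (fun p : ℝ × E => ((0 : ℝ), (h * p.1) • K p.2)) _ p :=
        (hasFDerivAt_const (0 : ℝ) p).prodMk (h1.smul h2)
      rw [h3.fderiv]
      refine ContinuousLinearMap.opNorm_le_bound _ (by norm_num) fun v => ?_
      have h4 : ‖v.1‖ ≤ ‖v‖ := norm_fst_le v
      have h5 : ‖v.2‖ ≤ ‖v‖ := norm_snd_le v
      have h6 := (fderiv ℝ K p.2).le_of_opNorm_le (hL p.2) v.2
      rw [ContinuousLinearMap.prod_apply, Prod.norm_def]
      refine max_le (by simp) ?_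
      simp only [add_apply, smul_apply,
        ContinuousLinearMap.comp_apply, ContinuousLinearMap.smulRight_apply,
        ContinuousLinearMap.coe_fst', ContinuousLinearMap.coe_snd', smul_eq_mul]
      calc _ ≤ ‖(h * p.1) • fderiv ℝ K p.2 v.2‖ + ‖(h * v.1) • K p.2‖ := norm_add_le _ _
        _ = h * |p.1| * ‖fderiv ℝ K p.2 v.2‖ + h * ‖v.1‖ * ‖K p.2‖ := by
          simp [norm_smul, abs_of_pos hh]
        _ ≤ h * 2 * (L * ‖v‖) + h * ‖v‖ * M := by
          have := hM p.2
          have h7 : ‖fderiv ℝ K p.2 v.2‖ ≤ L * ‖v‖ := h6.trans (by gcongr)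
          gcongr
        _ = h * (2 * L + M) * ‖v‖ := by ring
        _ ≤ 1 / 2 * ‖v‖ := by gcongr
    have h1 := contDiffOn_time_one_of_norm_fderiv_le_half hV
      (U := {p | |p.1| < 2}) (S := {p | |p.1| < 2})
      (isOpen_lt (by fun_prop) continuous_const)
      (by rw [hS]; exact (convex_ball _ _).prod convex_univ) hfd
      (φ := fun p t => (p.1, γ p.2 (h * p.1 * t))) (fun p _ => by simp [h0])
      (fun p _ t _ => by
        have h1 : HasDerivAt (fun t : ℝ => h * p.1 * t) (h * p.1) t := by
          simpa using (hasDerivAt_id t).const_mul (h * p.1)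
        exact ((hasDerivAt_const t p.1).prodMk
          ((hγ p.2 (h * p.1 * t)).scomp t h1)).hasDerivWithinAt)
      (fun p hp t _ => hp)
    exact (contDiff_snd.comp_contDiffOn h1).congr fun p _ => by simp
  -- The group law extends smoothness from short times to times up to `2nh`, for every `n`.
  have hsmall' : ∀ n : ℕ, ContDiffOn ℝ 1 (fun p : ℝ × E => γ p.2 (n * (h * p.1)))
      {p | |p.1| < 2} := by
    intro n
    induction n with
    | zero => simpa [h0] using contDiff_snd.contDiffOn
    | succ n ih =>
      have h1 : (fun p : ℝ × E => γ p.2 ((n + 1 : ℕ) * (h * p.1)))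
          = (fun p : ℝ × E => γ p.2 (h * p.1)) ∘ fun p => (p.1, γ p.2 (n * (h * p.1))) := by
        ext p
        simp only [Function.comp]
        rw [← hadd]; push_cast; ring_nf
      rw [h1]
      exact hsmall.comp (contDiff_fst.contDiffOn.prodMk ih) fun p hp => hp
  rw [contDiff_iff_contDiffAt]
  intro p
  obtain ⟨n, hn⟩ := exists_nat_gt (|p.1| / (2 * h))
  have hn0 : (0 : ℝ) < n := lt_of_le_of_lt (by positivity) hn
  have hlt : |p.1 / (n * h)| < 2 := by
    rw [abs_div, abs_of_pos (by positivity : 0 < n * h), div_lt_iff₀ (by positivity)]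
    rw [div_lt_iff₀ (by positivity)] at hn
    linarith
  have h1 : (fun p : ℝ × E => γ p.2 p.1) = (fun p : ℝ × E => γ p.2 (n * (h * p.1))) ∘
      fun p => (p.1 / (n * h), p.2) := by
    ext p
    simp only [Function.comp]
    congr 1
    field_simp
  rw [h1]
  have hopen : IsOpen {p : ℝ × E | |p.1| < 2} := isOpen_lt (by fun_prop) continuous_const
  exact ((hsmall' n).contDiffAt (hopen.mem_nhds hlt)).comp p (by fun_prop)

/-! ### Contracting fields and the flow with one coordinate as time. -/

namespace MeanField

theorem diag_apply (N : ℕ) (s : ℝ) (i : Fin N) : diag N s i = s := rfl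

theorem diag_add (N : ℕ) (s t : ℝ) : diag N (s + t) = diag N s + diag N t := rfl

theorem diag_one (N : ℕ) : diag N 1 = 1 := rfl

theorem diag_zero (N : ℕ) : diag N 0 = 0 := rfl

theorem hasDerivAt_diag (N : ℕ) (s : ℝ) : HasDerivAt (diag N) 1 s :=
  hasDerivAt_pi.2 fun _ => hasDerivAt_id s

/-- A bounded periodic `C¹` field whose component `o` is positive, and which, when the coordinate
`o` is used as time, contracts the sections of the tube of width `w` around the diagonal. -/
structure ContractingField {N : ℕ} (V : (Fin N → ℝ) → (Fin N → ℝ)) (o : Fin N) (w b : ℝ → ℝ)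
    (lam c M L : ℝ) : Prop where
  contDiff : ContDiff ℝ 1 V
  periodic : Function.Periodic V 1
  norm_le : ∀ X, ‖V X‖ ≤ M
  norm_fderiv_le : ∀ X, ‖fderiv ℝ V X‖ ≤ L
  c_pos : 0 < c
  le_apply : ∀ X, c ≤ V X o
  lam_pos : 0 < lam
  w_pos : ∀ s, 0 < w s
  w_periodic : Function.Periodic w 1
  -- Thus `w` grows faster by the rate `lam` than solutions of `u' = b u`.
  w_deriv : ∀ s, HasDerivAt w (w s * (b s + lam)) s
  -- Required only in the outer half of the tube: a perturbation need not preserve the diagonal,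
  -- where a bound proportional to the distance would fail.
  fence : ∀ X, w (X o) / 2 ≤ ‖X - diag N (X o)‖ → ‖X - diag N (X o)‖ ≤ w (X o) →
    ∀ i, |V X i / V X o - 1 - b (X o) * (X i - X o)| < lam * ‖X - diag N (X o)‖
  contraction : ∀ X X', X o = X' o → ‖X - diag N (X o)‖ ≤ w (X o) →
    ‖X' - diag N (X' o)‖ ≤ w (X' o) →
    ∀ i, |V X i / V X o - V X' i / V X' o - b (X o) * (X i - X' i)| ≤ lam / 2 * ‖X - X'‖

/-- `φ` is the flow of `V` with the coordinate `o` as time, and `A` is the elapsed original time. -/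
structure SectionFlow {N : ℕ} (V : (Fin N → ℝ) → (Fin N → ℝ)) (o : Fin N)
    (φ : ℝ → (Fin N → ℝ) → (Fin N → ℝ)) (A : ℝ → (Fin N → ℝ) → ℝ) : Prop where
  zero : ∀ X, φ 0 X = X
  time_zero : ∀ X, A 0 X = 0
  hasDerivAt : ∀ σ X, HasDerivAt (fun s => φ s X) ((V (φ σ X) o)⁻¹ • V (φ σ X)) σ
  time_hasDerivAt : ∀ σ X, HasDerivAt (fun s => A s X) (V (φ σ X) o)⁻¹ σ
  contDiff : ContDiff ℝ 1 (fun p : ℝ × (Fin N → ℝ) => φ p.1 p.2)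
  time_contDiff : ContDiff ℝ 1 (fun p : ℝ × (Fin N → ℝ) => A p.1 p.2)

variable {N : ℕ} {V : (Fin N → ℝ) → (Fin N → ℝ)} {o : Fin N} {w b : ℝ → ℝ} {lam c M L : ℝ}
  {φ : ℝ → (Fin N → ℝ) → (Fin N → ℝ)} {A : ℝ → (Fin N → ℝ) → ℝ}

namespace ContractingField

theorem apply_pos (h : ContractingField V o w b lam c M L) (X : Fin N → ℝ) : 0 < V X o :=
  h.c_pos.trans_le (h.le_apply X)

theorem inv_apply_le (h : ContractingField V o w b lam c M L) (X : Fin N → ℝ) :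
    (V X o)⁻¹ ≤ c⁻¹ := inv_anti₀ h.c_pos (h.le_apply X)

theorem apply_le (h : ContractingField V o w b lam c M L) (X : Fin N → ℝ) : V X o ≤ M :=
  (le_abs_self _).trans ((norm_le_pi_norm (V X) o).trans (h.norm_le X))

theorem bound_pos (h : ContractingField V o w b lam c M L) : 0 < M :=
  (h.apply_pos 0).trans_le (h.apply_le 0)

theorem fderiv_bound_nonneg (h : ContractingField V o w b lam c M L) : 0 ≤ L :=
  (norm_nonneg _).trans (h.norm_fderiv_le 0)

/-- The field of the section flow, together with the elapsed time. -/
theorem exists_bounds (h : ContractingField V o w b lam c M L) :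
    ContDiff ℝ 1 (fun p : (Fin N → ℝ) × ℝ => (V p.1 o)⁻¹ • (V p.1, (1 : ℝ))) ∧
    (∃ M', ∀ p : (Fin N → ℝ) × ℝ, ‖(V p.1 o)⁻¹ • (V p.1, (1 : ℝ))‖ ≤ M') ∧
    ∃ L', ∀ p, ‖fderiv ℝ (fun p : (Fin N → ℝ) × ℝ => (V p.1 o)⁻¹ • (V p.1, (1 : ℝ))) p‖ ≤ L' := by
  have hc := h.c_pos
  have hL := h.fderiv_bound_nonneg
  have hV1 : ContDiff ℝ 1 (fun p : (Fin N → ℝ) × ℝ => V p.1) := h.contDiff.comp contDiff_fst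
  have hVo : ContDiff ℝ 1 (fun p : (Fin N → ℝ) × ℝ => V p.1 o) := contDiff_pi.1 hV1 o
  have hn : ∀ p : (Fin N → ℝ) × ℝ, ‖(V p.1, (1 : ℝ))‖ ≤ max M 1 := fun p =>
    max_le_max (h.norm_le _) (by simp)
  have hi : ∀ X, ‖(V X o)⁻¹‖ ≤ c⁻¹ := fun X => by
    rw [Real.norm_of_nonneg (inv_pos.2 (h.apply_pos X)).le]; exact h.inv_apply_le X
  refine ⟨(hVo.inv fun p => (h.apply_pos _).ne').smul (hV1.prodMk contDiff_const),
    ⟨c⁻¹ * max M 1, fun p => ?_⟩, ⟨c⁻¹ * L + c⁻¹ ^ 2 * L * max M 1, fun p => ?_⟩⟩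
  · rw [norm_smul]
    have := hn p
    have := hi p.1
    gcongr
  · have h1 : HasFDerivAt (fun p : (Fin N → ℝ) × ℝ => V p.1)
        ((fderiv ℝ V p.1).comp (ContinuousLinearMap.fst ℝ _ ℝ)) p :=
      ((h.contDiff.differentiable one_ne_zero) p.1).hasFDerivAt.comp p hasFDerivAt_fst
    have h2 := (hasFDerivAt_pi'.1 h1) o
    have h3 := (hasDerivAt_inv (h.apply_pos p.1).ne').comp_hasFDerivAt p h2
    have h4 : HasFDerivAt (fun p : (Fin N → ℝ) × ℝ => (V p.1 o)⁻¹ • (V p.1, (1 : ℝ))) _ p :=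
      h3.smul (h1.prodMk (hasFDerivAt_const (1 : ℝ) p))
    rw [h4.fderiv]
    refine ContinuousLinearMap.opNorm_le_bound _ (by positivity) fun v => ?_
    have h5 : ‖fderiv ℝ V p.1 v.1‖ ≤ L * ‖v‖ :=
      ((fderiv ℝ V p.1).le_of_opNorm_le (h.norm_fderiv_le p.1) v.1).trans
        (by have := norm_fst_le v; gcongr)
    have h6 : ‖fderiv ℝ V p.1 v.1 o‖ ≤ L * ‖v‖ := (norm_le_pi_norm _ o).trans h5
    have h7 : ‖-(V p.1 o ^ 2)⁻¹‖ ≤ c⁻¹ ^ 2 := by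
      rw [norm_neg, ← inv_pow, norm_pow]
      have := hi p.1
      gcongr
    calc _ = ‖(V p.1 o)⁻¹ • (fderiv ℝ V p.1 v.1, (0 : ℝ)) +
          (-(V p.1 o ^ 2)⁻¹ * fderiv ℝ V p.1 v.1 o) • (V p.1, (1 : ℝ))‖ := by
          congr 1
      _ ≤ ‖(V p.1 o)⁻¹‖ * ‖(fderiv ℝ V p.1 v.1, (0 : ℝ))‖ +
          (‖-(V p.1 o ^ 2)⁻¹‖ * ‖fderiv ℝ V p.1 v.1 o‖) * ‖(V p.1, (1 : ℝ))‖ := by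
          refine (norm_add_le _ _).trans ?_
          rw [norm_smul, norm_smul, norm_mul]
      _ ≤ c⁻¹ * (L * ‖v‖) + (c⁻¹ ^ 2 * (L * ‖v‖)) * max M 1 := by
          have h8 : ‖(fderiv ℝ V p.1 v.1, (0 : ℝ))‖ ≤ L * ‖v‖ := by
            rw [Prod.norm_def, norm_zero]; exact max_le h5 (by positivity)
          have h9 := hn p
          have h10 := hi p.1
          gcongr
      _ = _ := by ring

theorem exists_sectionFlow (h : ContractingField V o w b lam c M L) :
    ∃ φ A, SectionFlow V o φ A := by
  obtain ⟨hK, ⟨M', hM'⟩, L', hL'⟩ := h.exists_bounds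
  obtain ⟨Z, h0, hZ, hZc⟩ := exists_contDiff_flow hK hM' hL'
  have hZ1 : ContDiff ℝ 1 (fun p : ℝ × (Fin N → ℝ) => Z p.1 (p.2, 0)) :=
    hZc.comp (contDiff_fst.prodMk (contDiff_snd.prodMk contDiff_const))
  exact ⟨fun σ X => (Z σ (X, 0)).1, fun σ X => (Z σ (X, 0)).2, fun X => by simp [h0],
    fun X => by simp [h0], fun σ X =>
      (ContinuousLinearMap.fst ℝ (Fin N → ℝ) ℝ).hasFDerivAt.comp_hasDerivAt σ (hZ σ (X, 0)),
    fun σ X => ((ContinuousLinearMap.snd ℝ (Fin N → ℝ) ℝ).hasFDerivAt.comp_hasDerivAt σ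
      (hZ σ (X, 0))).congr_deriv (by simp),
    contDiff_fst.comp hZ1, contDiff_snd.comp hZ1⟩

theorem exists_flow (h : ContractingField V o w b lam c M L) :
    ∃ ξ : ℝ → (Fin N → ℝ) → (Fin N → ℝ), (∀ X, ξ 0 X = X) ∧
      ∀ X t, HasDerivAt (fun s => ξ s X) (V (ξ t X)) t := by
  obtain ⟨ξ, h0, hξ, -⟩ := exists_contDiff_flow h.contDiff h.norm_le h.norm_fderiv_le
  exact ⟨ξ, h0, fun X t => hξ t X⟩

theorem lipschitzWith (h : ContractingField V o w b lam c M L) : LipschitzWith L.toNNReal V :=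
  lipschitzWith_of_norm_fderiv_le' h.contDiff h.norm_fderiv_le

theorem exists_lipschitzWith (h : ContractingField V o w b lam c M L) :
    ∃ L', LipschitzWith L' (fun p : (Fin N → ℝ) × ℝ => (V p.1 o)⁻¹ • (V p.1, (1 : ℝ))) := by
  obtain ⟨hK, -, L', hL'⟩ := h.exists_bounds
  exact ⟨_, lipschitzWith_of_norm_fderiv_le' hK hL'⟩

end ContractingField

namespace SectionFlow

theorem pair_hasDerivAt (hφ : SectionFlow V o φ A) (σ a : ℝ) (X : Fin N → ℝ) :
    HasDerivAt (fun s => (φ s X, A s X + a))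
      ((V (φ σ X) o)⁻¹ • (V (φ σ X), (1 : ℝ))) σ := by
  simpa using (hφ.hasDerivAt σ X).prodMk ((hφ.time_hasDerivAt σ X).add_const a)

theorem apply_self (h : ContractingField V o w b lam c M L) (hφ : SectionFlow V o φ A)
    (σ : ℝ) (X : Fin N → ℝ) : φ σ X o = X o + σ := by
  have h1 : ∀ s, HasDerivAt (fun s => φ s X o - s) 0 s := fun s => by
    have := ((hasDerivAt_pi.1 (hφ.hasDerivAt s X)) o).sub (hasDerivAt_id s)
    refine this.congr_deriv ?_
    simp [(h.apply_pos (φ s X)).ne']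
  have h2 := is_const_of_deriv_eq_zero (fun s => (h1 s).differentiableAt)
    (fun s => (h1 s).deriv) σ 0
  simp only [hφ.zero] at h2
  linarith

theorem pair_unique (h : ContractingField V o w b lam c M L) {f g : ℝ → (Fin N → ℝ) × ℝ}
    (hf : ∀ t, HasDerivAt f ((V (f t).1 o)⁻¹ • (V (f t).1, (1 : ℝ))) t)
    (hg : ∀ t, HasDerivAt g ((V (g t).1 o)⁻¹ • (V (g t).1, (1 : ℝ))) t) (h0 : f 0 = g 0) :
    f = g := by
  obtain ⟨L', hL'⟩ := h.exists_lipschitzWith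
  exact ODE_solution_unique_univ
    (v := fun _ => fun p : (Fin N → ℝ) × ℝ => (V p.1 o)⁻¹ • (V p.1, (1 : ℝ)))
    (s := fun _ => Set.univ) (t₀ := 0) (fun _ => hL'.lipschitzOnWith)
    (fun t => ⟨hf t, trivial⟩) (fun t => ⟨hg t, trivial⟩) h0

/-- Position and elapsed time together solve one autonomous Lipschitz equation that does not involve
the elapsed time; uniqueness then gives both the flow law and the cocycle law. -/
theorem pair_add (h : ContractingField V o w b lam c M L) (hφ : SectionFlow V o φ A)
    (s t : ℝ) (X : Fin N → ℝ) :
    φ (s + t) X = φ s (φ t X) ∧ A (s + t) X = A s (φ t X) + A t X := by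
  have := congrFun (pair_unique h (f := fun s => (φ (s + t) X, A (s + t) X + 0))
    (g := fun s => (φ s (φ t X), A s (φ t X) + A t X))
    (fun s => (hφ.pair_hasDerivAt (s + t) 0 X).comp_add_const s t)
    (fun s => hφ.pair_hasDerivAt s _ _) (by simp [hφ.zero, hφ.time_zero])) s
  simpa using this

theorem pair_shift (h : ContractingField V o w b lam c M L) (hφ : SectionFlow V o φ A)
    (s : ℝ) (X : Fin N → ℝ) : φ s (X + 1) = φ s X + 1 ∧ A s (X + 1) = A s X := by
  have := congrFun (pair_unique h (f := fun s => (φ s (X + 1), A s (X + 1) + 0))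
    (g := fun s => (φ s X + 1, A s X))
    (fun s => hφ.pair_hasDerivAt s 0 _)
    (fun s => by
      have := (hφ.pair_hasDerivAt s 0 X).add_const ((1 : Fin N → ℝ), (0 : ℝ))
      simpa [h.periodic (φ s X)] using this) (by simp [hφ.zero, hφ.time_zero])) s
  simpa using this

theorem le_time (h : ContractingField V o w b lam c M L) (hφ : SectionFlow V o φ A)
    {σ : ℝ} (hσ : 0 ≤ σ) (X : Fin N → ℝ) : σ / M ≤ A σ X ∧ A σ X ≤ σ / c := by
  have hd : Differentiable ℝ (fun s => A s X) := fun s => (hφ.time_hasDerivAt s X).differentiableAt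
  have hder : ∀ s, deriv (fun s => A s X) s = (V (φ s X) o)⁻¹ := fun s =>
    (hφ.time_hasDerivAt s X).deriv
  constructor
  · have := mul_sub_le_image_sub_of_le_deriv hd (C := M⁻¹) (fun s => by
      rw [hder]; exact inv_anti₀ (h.apply_pos _) (h.apply_le _)) hσ
    rw [hφ.time_zero] at this
    rw [div_eq_inv_mul]; linarith
  · have := image_sub_le_mul_sub_of_deriv_le hd (C := c⁻¹) (fun s => by
      rw [hder]; exact h.inv_apply_le _) hσ
    rw [hφ.time_zero] at this
    rw [div_eq_inv_mul]; linarith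

/-- The section flow is a time change of the flow. -/
theorem flow_time (h : ContractingField V o w b lam c M L) (hφ : SectionFlow V o φ A)
    {ξ : ℝ → Fin N → ℝ} (hξ : ∀ t, HasDerivAt ξ (V (ξ t)) t) (σ : ℝ) :
    ξ (A σ (ξ 0)) = φ σ (ξ 0) := by
  -- The clock rate is frozen along `φ`. Both curves solve the resulting nonautonomous equation,
  -- which is Lipschitz in `X` because the rate depends on `s` alone.
  refine congrFun (ODE_solution_unique_univ
    (v := fun s X => (V (φ s (ξ 0)) o)⁻¹ • V X) (s := fun _ => Set.univ)
    (f := fun σ => ξ (A σ (ξ 0))) (g := fun σ => φ σ (ξ 0)) (t₀ := 0)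
    (K := c⁻¹.toNNReal * L.toNNReal) (fun s => ?_)
    (fun s => ⟨(hξ _).scomp s (hφ.time_hasDerivAt s _), trivial⟩)
    (fun s => ⟨hφ.hasDerivAt s _, trivial⟩) (by simp [hφ.zero, hφ.time_zero])) σ
  refine (LipschitzWith.of_dist_le_mul fun X Y => ?_).lipschitzOnWith
  rw [dist_smul₀, NNReal.coe_mul, Real.coe_toNNReal _ (inv_pos.2 h.c_pos).le,
    Real.norm_of_nonneg (inv_pos.2 (h.apply_pos _)).le, mul_assoc]
  have := h.lipschitzWith.dist_le_mul X Y
  have := h.inv_apply_le (φ s (ξ 0))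
  have := inv_pos.2 h.c_pos
  gcongr

theorem exists_time_lipschitz (h : ContractingField V o w b lam c M L)
    (hφ : SectionFlow V o φ A) : ∃ C, 0 ≤ C ∧ ∀ X X', |A 1 X - A 1 X'| ≤ C * ‖X - X'‖ := by
  obtain ⟨L', hL'⟩ := h.exists_lipschitzWith
  refine ⟨Real.exp L', (Real.exp_pos _).le, fun X X' => ?_⟩
  have hc : ∀ X, Continuous (fun s => (φ s X, A s X + 0)) := fun X =>
    continuous_iff_continuousAt.2 fun s => (hφ.pair_hasDerivAt s 0 X).continuousAt
  have := dist_le_of_trajectories_ODE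
    (v := fun _ => fun p : (Fin N → ℝ) × ℝ => (V p.1 o)⁻¹ • (V p.1, (1 : ℝ)))
    (a := 0) (b := 1) (fun _ => hL') (hc X).continuousOn
    (fun s _ => (hφ.pair_hasDerivAt s 0 X).hasDerivWithinAt) (hc X').continuousOn
    (fun s _ => (hφ.pair_hasDerivAt s 0 X').hasDerivWithinAt) le_rfl 1 (by simp)
  rw [Prod.dist_eq, Prod.dist_eq] at this
  have h2 := (le_max_right _ _).trans this
  simp only [hφ.zero, hφ.time_zero, add_zero, dist_self, dist_nonneg, sup_of_le_left] at h2
  rw [Real.dist_eq, dist_eq_norm] at h2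
  simpa [mul_comm] using h2

end SectionFlow

end MeanField

/-! ### Invariance of the tube, contraction of its sections, the fixed point of the return map. -/

namespace MeanField

variable {N : ℕ} {V : (Fin N → ℝ) → (Fin N → ℝ)} {o : Fin N} {w b : ℝ → ℝ} {lam c M L : ℝ}
  {φ : ℝ → (Fin N → ℝ) → (Fin N → ℝ)} {A : ℝ → (Fin N → ℝ) → ℝ}

namespace ContractingField

/-- The integrating factor of the transverse linearization. -/
theorem hasDerivAt_factor (h : ContractingField V o w b lam c M L) (s σ : ℝ) :
    HasDerivAt (fun σ => Real.exp (lam * σ) / w (s + σ))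
      (-(b (s + σ) * (Real.exp (lam * σ) / w (s + σ)))) σ := by
  have h1 : HasDerivAt (fun σ => Real.exp (lam * σ)) (Real.exp (lam * σ) * lam) σ := by
    simpa using ((hasDerivAt_id σ).const_mul lam).exp
  have h2 : HasDerivAt (fun σ => w (s + σ)) (w (s + σ) * (b (s + σ) + lam)) σ :=
    (h.w_deriv (s + σ)).comp_const_add s σ
  refine (h1.div h2 (h.w_pos _).ne').congr_deriv ?_
  have := (h.w_pos (s + σ)).ne'
  field_simp
  ring

theorem factor_pos (h : ContractingField V o w b lam c M L) (s σ : ℝ) :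
    0 < Real.exp (lam * σ) / w (s + σ) := div_pos (Real.exp_pos _) (h.w_pos _)

end ContractingField

namespace SectionFlow

/-- The factor `μ = exp (lam σ) / w` satisfies `μ' = -b μ`, so it removes the linear term from the
equation of the deviation `u`. By `fence`, `‖μ u‖` grows strictly slower than `κ exp (lam σ)`
whenever it touches this barrier. The value `κ = 1/2` serves the fixed point, `κ = 1` the
contraction. -/
theorem norm_sub_diag_le (h : ContractingField V o w b lam c M L) (hφ : SectionFlow V o φ A)
    {κ : ℝ} (hκ : 1 / 2 ≤ κ) (hκ1 : κ ≤ 1) {X : Fin N → ℝ}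
    (hX : ‖X - diag N (X o)‖ ≤ κ * w (X o)) {σ : ℝ} (hσ : 0 ≤ σ) :
    ‖φ σ X - diag N (X o + σ)‖ ≤ κ * w (X o + σ) := by
  set s := X o
  set u : ℝ → Fin N → ℝ := fun σ => φ σ X - diag N (s + σ)
  set μ : ℝ → ℝ := fun σ => Real.exp (lam * σ) / w (s + σ)
  have hμ : ∀ σ, 0 < μ σ := fun σ => h.factor_pos s σ
  have hu : ∀ σ, HasDerivAt u ((V (φ σ X) o)⁻¹ • V (φ σ X) - 1) σ := fun σ =>
    (hφ.hasDerivAt σ X).sub ((hasDerivAt_diag N (s + σ)).comp_const_add s σ)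
  have hf : ∀ σ, HasDerivAt (fun σ => μ σ • u σ)
      (μ σ • ((V (φ σ X) o)⁻¹ • V (φ σ X) - 1) + (-(b (s + σ) * μ σ)) • u σ) σ := fun σ =>
    (h.hasDerivAt_factor s σ).smul (hu σ)
  have hB : ∀ σ, HasDerivAt (fun σ => κ * Real.exp (lam * σ)) (κ * (Real.exp (lam * σ) * lam)) σ :=
    fun σ => by simpa using (((hasDerivAt_id σ).const_mul lam).exp).const_mul κ
  have key := image_norm_le_of_norm_deriv_right_lt_deriv_boundary
    (f := fun σ => μ σ • u σ) (a := 0) (b := σ)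
    (fun σ _ => (hf σ).continuousAt.continuousWithinAt) (fun σ _ => (hf σ).hasDerivWithinAt)
    (B := fun σ => κ * Real.exp (lam * σ)) (by
      have h1 : u 0 = X - diag N s := by simp [u, hφ.zero]
      have h2 : μ 0 = (w s)⁻¹ := by simp [μ]
      rw [h1, h2, norm_smul, Real.norm_of_nonneg (inv_pos.2 (h.w_pos s)).le, inv_mul_le_iff₀
        (h.w_pos s)]
      simp only [mul_zero, Real.exp_zero, mul_one]
      rwa [mul_comm]) hB
    (fun t _ hn => by
      have hxo : φ t X o = s + t := hφ.apply_self h t X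
      have hn1 : ‖φ t X - diag N (φ t X o)‖ = κ * w (s + t) := by
        rw [norm_smul, Real.norm_of_nonneg (hμ t).le] at hn
        rw [hxo]
        have h3 := (Real.exp_pos (lam * t)).ne'
        have h4 := (h.w_pos (s + t)).ne'
        simp only [μ, u] at hn
        field_simp at hn
        linarith
      have hw := h.w_pos (s + t)
      have hfence := h.fence (φ t X) (by rw [hn1, hxo]; nlinarith) (by rw [hn1, hxo]; nlinarith)
      rw [hn1, hxo] at hfence
      have hpos : 0 < κ * (Real.exp (lam * t) * lam) := by
        have := h.lam_pos
        have := Real.exp_pos (lam * t)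
        have : 0 < κ := by linarith
        positivity
      rw [pi_norm_lt_iff hpos]
      intro i
      have h5 : (μ t • ((V (φ t X) o)⁻¹ • V (φ t X) - 1) + (-(b (s + t) * μ t)) • u t) i
          = μ t * (V (φ t X) i / V (φ t X) o - 1 - b (s + t) * (φ t X i - (s + t))) := by
        simp [u, diag_apply]; ring
      rw [h5, norm_mul, Real.norm_of_nonneg (hμ t).le, Real.norm_eq_abs]
      calc _ < μ t * (lam * (κ * w (s + t))) := mul_lt_mul_of_pos_left (hfence i) (hμ t)
        _ = κ * (Real.exp (lam * t) * lam) := by simp only [μ]; field_simp)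
    (Set.right_mem_Icc.2 hσ)
  rw [norm_smul, Real.norm_of_nonneg (hμ σ).le] at key
  have h4 := h.w_pos (s + σ)
  have h3 := Real.exp_pos (lam * σ)
  simp only [μ, u] at key
  rw [div_mul_eq_mul_div, div_le_iff₀ h4] at key
  nlinarith

/-- With the same factor `μ`, the weighted difference grows at rate at most `lam / 2` by Grönwall,
while `μ` contributes `exp (lam σ)`: half of the rate survives. -/
theorem norm_sub_le (h : ContractingField V o w b lam c M L) (hφ : SectionFlow V o φ A)
    {X Y : Fin N → ℝ} (hXY : X o = Y o) (hX : ‖X - diag N (X o)‖ ≤ w (X o))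
    (hY : ‖Y - diag N (Y o)‖ ≤ w (Y o)) {σ : ℝ} (hσ : 0 ≤ σ) :
    ‖φ σ X - φ σ Y‖ ≤ w (X o + σ) / w (X o) * Real.exp (-(lam / 2 * σ)) * ‖X - Y‖ := by
  set s := X o
  have hYs : Y o = s := hXY.symm
  set u : ℝ → Fin N → ℝ := fun σ => φ σ X - φ σ Y
  set μ : ℝ → ℝ := fun σ => Real.exp (lam * σ) / w (s + σ)
  have hμ : ∀ σ, 0 < μ σ := fun σ => h.factor_pos s σ
  have hu : ∀ σ, HasDerivAt u ((V (φ σ X) o)⁻¹ • V (φ σ X) - (V (φ σ Y) o)⁻¹ • V (φ σ Y)) σ :=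
    fun σ => (hφ.hasDerivAt σ X).sub (hφ.hasDerivAt σ Y)
  have hf : ∀ σ, HasDerivAt (fun σ => μ σ • u σ)
      (μ σ • ((V (φ σ X) o)⁻¹ • V (φ σ X) - (V (φ σ Y) o)⁻¹ • V (φ σ Y)) +
        (-(b (s + σ) * μ σ)) • u σ) σ := fun σ =>
    (h.hasDerivAt_factor s σ).smul (hu σ)
  have key := norm_le_gronwallBound_of_norm_deriv_right_le (K := lam / 2) (ε := 0)
    (f := fun σ => μ σ • u σ) (a := 0) (b := σ)
    (fun σ _ => (hf σ).continuousAt.continuousWithinAt) (fun σ _ => (hf σ).hasDerivWithinAt)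
    le_rfl
    (fun t ht => by
      have hxo : φ t X o = s + t := hφ.apply_self h t X
      have hyo : φ t Y o = s + t := by rw [hφ.apply_self h t Y, hYs]
      have h1 := norm_sub_diag_le h hφ (κ := 1) (by norm_num) le_rfl (X := X) (by simpa using hX)
        ht.1
      have h2 := norm_sub_diag_le h hφ (κ := 1) (by norm_num) le_rfl (X := Y) (by simpa using hY)
        ht.1
      rw [one_mul] at h1 h2
      have hcon := h.contraction (φ t X) (φ t Y) (hxo.trans hyo.symm) (by rw [hxo]; exact h1)
        (by rw [hyo, ← hYs]; exact h2)
      rw [hxo] at hcon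
      have hl := h.lam_pos
      rw [add_zero, pi_norm_le_iff_of_nonneg (by positivity)]
      intro i
      have h5 : (μ t • ((V (φ t X) o)⁻¹ • V (φ t X) - (V (φ t Y) o)⁻¹ • V (φ t Y)) +
          (-(b (s + t) * μ t)) • u t) i
          = μ t * (V (φ t X) i / V (φ t X) o - V (φ t Y) i / V (φ t Y) o -
            b (s + t) * (φ t X i - φ t Y i)) := by
        simp [u]; ring
      rw [h5, norm_mul, norm_smul, Real.norm_of_nonneg (hμ t).le, Real.norm_eq_abs]
      calc _ ≤ μ t * (lam / 2 * ‖φ t X - φ t Y‖) := mul_le_mul_of_nonneg_left (hcon i) (hμ t).le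
        _ = _ := by simp only [u]; ring)
    σ (Set.right_mem_Icc.2 hσ)
  rw [gronwallBound_ε0, norm_smul, norm_smul, Real.norm_of_nonneg (hμ σ).le,
    Real.norm_of_nonneg (hμ 0).le, sub_zero] at key
  have h0 : u 0 = X - Y := by simp [u, hφ.zero]
  have h4 := h.w_pos (s + σ)
  have h3 := Real.exp_pos (lam * σ)
  rw [h0] at key
  simp only [μ, u, mul_zero, Real.exp_zero, add_zero] at key
  rw [div_mul_eq_mul_div, div_le_iff₀ h4] at key
  have h6 : Real.exp (-(lam / 2 * σ)) = Real.exp (lam / 2 * σ) / Real.exp (lam * σ) := by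
    rw [← Real.exp_sub]; ring_nf
  rw [h6]
  have h7 : w (s + σ) / w s * (Real.exp (lam / 2 * σ) / Real.exp (lam * σ)) * ‖X - Y‖
      = (1 / w s * ‖X - Y‖ * Real.exp (lam / 2 * σ) * w (s + σ)) / Real.exp (lam * σ) := by ring
  rw [h7, le_div_iff₀ h3]
  linarith

theorem exists_uniform_norm_sub_le (h : ContractingField V o w b lam c M L)
    (hφ : SectionFlow V o φ A) : ∃ C > 0, ∀ X Y : Fin N → ℝ, X o = Y o →
      ‖X - diag N (X o)‖ ≤ w (X o) → ‖Y - diag N (Y o)‖ ≤ w (Y o) → ∀ σ, 0 ≤ σ →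
      ‖φ σ X - φ σ Y‖ ≤ C * Real.exp (-(lam / 2 * σ)) * ‖X - Y‖ := by
  have hwc : Continuous w := continuous_iff_continuousAt.2 fun s => (h.w_deriv s).continuousAt
  obtain ⟨p, -, hp⟩ := isCompact_Icc.exists_isMinOn (s := Set.Icc (0 : ℝ) 1) ⟨0, by simp⟩
    hwc.continuousOn
  obtain ⟨q, -, hq⟩ := isCompact_Icc.exists_isMaxOn (s := Set.Icc (0 : ℝ) 1) ⟨0, by simp⟩
    hwc.continuousOn
  have hmin : ∀ s, w p ≤ w s := fun s => by
    obtain ⟨y, hy, hys⟩ := h.w_periodic.exists_mem_Ico₀ one_pos s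
    rw [hys]; exact hp ⟨hy.1, hy.2.le⟩
  have hmax : ∀ s, w s ≤ w q := fun s => by
    obtain ⟨y, hy, hys⟩ := h.w_periodic.exists_mem_Ico₀ one_pos s
    rw [hys]; exact hq ⟨hy.1, hy.2.le⟩
  refine ⟨w q / w p, div_pos (h.w_pos q) (h.w_pos p), fun X Y hXY hX hY σ hσ => ?_⟩
  refine (norm_sub_le h hφ hXY hX hY hσ).trans ?_
  have := h.w_pos p
  have := h.w_pos q
  have := hmax (X o + σ)
  have := hmin (X o)
  gcongr

/-- Banach's theorem for the return map, translated by `-1`, on the half-width disc of the section.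
As `w 1 = w 0`, the weights in `norm_sub_le` cancel and the contraction factor is `exp (-lam / 2)`.
-/
theorem exists_fixedPoint (h : ContractingField V o w b lam c M L) (hφ : SectionFlow V o φ A) :
    ∃ X₀ : Fin N → ℝ, X₀ o = 0 ∧ ‖X₀‖ ≤ w 0 / 2 ∧ φ 1 X₀ = X₀ + 1 := by
  have hw0 := h.w_pos 0
  have hw1 : w 1 = w 0 := by simpa using h.w_periodic 0
  set S : Set (Fin N → ℝ) := {X | X o = 0 ∧ ‖X‖ ≤ w 0 / 2}
  have hS : IsClosed S := (isClosed_eq (continuous_apply o) continuous_const).inter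
    (isClosed_le continuous_norm continuous_const)
  set P : (Fin N → ℝ) → (Fin N → ℝ) := fun X => φ 1 X - 1
  have hle : ∀ X ∈ S, ‖X - diag N (X o)‖ ≤ 1 / 2 * w (X o) := by
    rintro X ⟨h1, h2⟩
    rw [h1, diag_zero, sub_zero]; linarith
  have hmaps : Set.MapsTo P S S := by
    intro X hX
    refine ⟨by simp [P, hφ.apply_self h, hX.1], ?_⟩
    have := norm_sub_diag_le h hφ le_rfl (by norm_num) (hle X hX) zero_le_one
    rw [hX.1, zero_add, diag_one, hw1] at this
    simp only [P]; linarith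
  have hq : 0 ≤ Real.exp (-(lam / 2 * 1)) := (Real.exp_pos _).le
  have hcontr : ContractingWith (Real.exp (-(lam / 2 * 1))).toNNReal (hmaps.restrict P S S) := by
    refine ⟨?_, LipschitzWith.of_dist_le_mul fun X Y => ?_⟩
    · rw [Real.toNNReal_lt_one]
      have := h.lam_pos
      exact (Real.exp_lt_exp.2 (show _ < (0 : ℝ) by linarith)).trans_eq Real.exp_zero
    · have hX := hle X X.2
      have hY := hle Y Y.2
      have := norm_sub_le h hφ (X := X) (Y := Y) (by rw [X.2.1, Y.2.1])
        (hX.trans (by linarith [h.w_pos ((X : Fin N → ℝ) o)]))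
        (hY.trans (by linarith [h.w_pos ((Y : Fin N → ℝ) o)])) zero_le_one
      rw [X.2.1, zero_add, hw1, div_self hw0.ne', one_mul] at this
      rw [Subtype.dist_eq, Subtype.dist_eq, dist_eq_norm, dist_eq_norm, Real.coe_toNNReal _ hq]
      simpa [P] using this
  obtain ⟨X₀, hX₀, hfix, -⟩ := hcontr.exists_fixedPoint' hS.isComplete hmaps (x := 0)
    ⟨rfl, by rw [norm_zero]; positivity⟩ (edist_ne_top _ _)
  refine ⟨X₀, hX₀.1, hX₀.2, ?_⟩
  rw [← sub_eq_iff_eq_add]; exact hfix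

end SectionFlow

end MeanField

/-! ### Differentiable series, time along the section flow, orbital stability. -/

/-- On an open set Lipschitz constants bound the derivatives, so the differentiated series converges
uniformly; convergence at `x₀` then spreads over the connected set. -/
theorem contDiffOn_one_tsum_of_lipschitz {E : Type*} [NormedAddCommGroup E] [NormedSpace ℝ E]
    {f : ℕ → E → ℝ} {s : Set E} {u : ℕ → ℝ} {x₀ : E} (hs : IsOpen s) (hs' : Convex ℝ s)
    (hu : Summable u) (hu0 : ∀ n, 0 ≤ u n) (hf : ∀ n, ContDiff ℝ 1 (f n))
    (hlip : ∀ n, ∀ x ∈ s, ∀ y ∈ s, |f n x - f n y| ≤ u n * ‖x - y‖) (hx₀ : x₀ ∈ s)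
    (h0 : ∀ n, f n x₀ = 0) : ContDiffOn ℝ 1 (fun x => ∑' n, f n x) s := by
  have hbound : ∀ n, ∀ x ∈ s, ‖fderiv ℝ (f n) x‖ ≤ u n := by
    intro n x hx
    have := norm_fderiv_le_of_lipschitzOn ℝ (hs.mem_nhds hx) (f := f n) (C := (u n).toNNReal)
      (LipschitzOnWith.of_dist_le_mul fun x hx y hy => by
        rw [Real.dist_eq, dist_eq_norm, Real.coe_toNNReal _ (hu0 n)]; exact hlip n x hx y hy)
    rwa [Real.coe_toNNReal _ (hu0 n)] at this
  intro x hx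
  refine ContDiffAt.contDiffWithinAt (contDiffAt_one_iff.2
    ⟨fun x => ∑' n, fderiv ℝ (f n) x, s, hs.mem_nhds hx, ?_, fun y hy => ?_⟩)
  · exact continuousOn_tsum (fun n => ((hf n).continuous_fderiv one_ne_zero).continuousOn) hu
      hbound
  · exact hasFDerivAt_tsum_of_isPreconnected hu hs hs'.isPreconnected
      (fun n y _ => ((hf n).differentiable one_ne_zero y).hasFDerivAt) hbound hx₀
      (by simp [h0, summable_zero]) hy

namespace MeanField

variable {N : ℕ} {V : (Fin N → ℝ) → (Fin N → ℝ)} {o : Fin N} {w b : ℝ → ℝ} {lam c M L : ℝ}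
  {φ : ℝ → (Fin N → ℝ) → (Fin N → ℝ)} {A : ℝ → (Fin N → ℝ) → ℝ} {X₀ : Fin N → ℝ}

/-- The open tube of width `w` around the diagonal, in section coordinates. -/
def sectionTube {N : ℕ} (o : Fin N) (w : ℝ → ℝ) : Set (Fin N → ℝ) :=
  {X | ‖X - diag N (X o)‖ < w (X o)}

namespace SectionFlow

theorem time_continuous (hφ : SectionFlow V o φ A) (X : Fin N → ℝ) :
    Continuous (fun σ => A σ X) :=
  continuous_iff_continuousAt.2 fun σ => (hφ.time_hasDerivAt σ X).continuousAt

theorem time_le_of_nonpos (h : ContractingField V o w b lam c M L) (hφ : SectionFlow V o φ A)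
    {σ : ℝ} (hσ : σ ≤ 0) (X : Fin N → ℝ) : A σ X ≤ σ / M := by
  have h1 := hφ.pair_add h σ (-σ) (φ σ X)
  have h2 := (hφ.pair_add h (-σ) σ X).2
  rw [neg_add_cancel, hφ.time_zero] at h2
  have h3 := (hφ.le_time h (neg_nonneg.2 hσ) (φ σ X)).1
  rw [neg_div] at h3
  linarith

theorem time_surjective (h : ContractingField V o w b lam c M L) (hφ : SectionFlow V o φ A)
    (X : Fin N → ℝ) : Function.Surjective (fun σ => A σ X) := by
  have hM := h.bound_pos
  refine (hφ.time_continuous X).surjective ?_ ?_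
  · refine Filter.tendsto_atTop_mono' _ ?_ (Filter.tendsto_id.atTop_div_const hM)
    filter_upwards [Filter.eventually_ge_atTop 0] with σ hσ using (hφ.le_time h hσ X).1
  · refine Filter.tendsto_atBot_mono' _ ?_ (Filter.tendsto_id.atBot_div_const hM)
    filter_upwards [Filter.eventually_le_atBot 0] with σ hσ using hφ.time_le_of_nonpos h hσ X

theorem exists_time_eq (h : ContractingField V o w b lam c M L) (hφ : SectionFlow V o φ A)
    (X : Fin N → ℝ) {t : ℝ} (ht : 0 ≤ t) : ∃ σ, A σ X = t ∧ 0 ≤ σ ∧ c * t ≤ σ := by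
  obtain ⟨σ, hσ⟩ := hφ.time_surjective h X t
  have hσ' : A σ X = t := hσ
  have h0 : 0 ≤ σ := by
    by_contra! hneg
    have h1 := hφ.time_le_of_nonpos h hneg.le X
    have h2 := div_neg_of_neg_of_pos hneg h.bound_pos
    linarith
  refine ⟨σ, hσ', h0, ?_⟩
  have h3 := (hφ.le_time h h0 X).2
  rw [hσ', le_div_iff₀ h.c_pos] at h3
  linarith

theorem fixed_add_one (h : ContractingField V o w b lam c M L) (hφ : SectionFlow V o φ A)
    (hX₀ : φ 1 X₀ = X₀ + 1) (σ : ℝ) : φ (σ + 1) X₀ = φ σ X₀ + 1 := by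
  rw [(hφ.pair_add h σ 1 X₀).1, hX₀, (hφ.pair_shift h σ X₀).1]

theorem fixed_nat (h : ContractingField V o w b lam c M L) (hφ : SectionFlow V o φ A)
    (hX₀ : φ 1 X₀ = X₀ + 1) (n : ℕ) : φ n X₀ = X₀ + diag N n ∧ A 1 (φ n X₀) = A 1 X₀ := by
  induction n with
  | zero => simp [hφ.zero, diag_zero]
  | succ n ih =>
    rw [Nat.cast_succ, hφ.fixed_add_one h hX₀, (hφ.pair_shift h 1 _).2, ih.1, diag_add, diag_one,
      add_assoc]
    refine ⟨rfl, ?_⟩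
    rw [← ih.1, ih.2]

theorem time_nat (h : ContractingField V o w b lam c M L) (hφ : SectionFlow V o φ A)
    (n : ℕ) (X : Fin N → ℝ) : A n X = ∑ k ∈ Finset.range n, A 1 (φ k X) := by
  induction n with
  | zero => simp [hφ.time_zero]
  | succ n ih =>
    rw [Finset.sum_range_succ, ← ih, Nat.cast_succ, add_comm (n : ℝ) 1, (hφ.pair_add h 1 n X).2,
      add_comm]

theorem fixed_time_nat (h : ContractingField V o w b lam c M L) (hφ : SectionFlow V o φ A)
    (hX₀ : φ 1 X₀ = X₀ + 1) (n : ℕ) : A n X₀ = n * A 1 X₀ := by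
  rw [hφ.time_nat h]
  simp [(hφ.fixed_nat h hX₀ _).2]

/-- Forward invariance covers `σ ≥ 0`; periodicity modulo the diagonal reaches negative `σ`. -/
theorem fixed_norm_sub_diag_le (h : ContractingField V o w b lam c M L)
    (hφ : SectionFlow V o φ A) (h0 : X₀ o = 0) (hw : ‖X₀‖ ≤ w 0 / 2) (hX₀ : φ 1 X₀ = X₀ + 1)
    (σ : ℝ) : ‖φ σ X₀ - diag N σ‖ ≤ w σ / 2 := by
  have hper : Function.Periodic (fun σ => ‖φ σ X₀ - diag N σ‖ - w σ / 2) 1 := fun σ => by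
    simp only [hφ.fixed_add_one h hX₀, diag_add, diag_one, h.w_periodic σ, add_sub_add_right_eq_sub]
  obtain ⟨s, hs, hσs⟩ := hper.exists_mem_Ico₀ one_pos σ
  have h1 := hφ.norm_sub_diag_le h le_rfl (by norm_num) (X := X₀)
    (by rw [h0, diag_zero, sub_zero]; linarith) hs.1
  rw [h0, zero_add] at h1
  linarith

theorem period_pos (h : ContractingField V o w b lam c M L) (hφ : SectionFlow V o φ A)
    (X : Fin N → ℝ) : 0 < A 1 X :=
  lt_of_lt_of_le (div_pos one_pos h.bound_pos) (hφ.le_time h zero_le_one X).1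

variable {ξ : ℝ → (Fin N → ℝ) → (Fin N → ℝ)}

theorem flow_time' (h : ContractingField V o w b lam c M L) (hφ : SectionFlow V o φ A)
    (hξ0 : ∀ X, ξ 0 X = X) (hξ : ∀ X t, HasDerivAt (fun s => ξ s X) (V (ξ t X)) t)
    (σ : ℝ) (X : Fin N → ℝ) : ξ (A σ X) X = φ σ X := by
  have := hφ.flow_time h (ξ := fun t => ξ t X) (hξ X) σ
  simpa [hξ0] using this

theorem range_flow (h : ContractingField V o w b lam c M L) (hφ : SectionFlow V o φ A)
    (hξ0 : ∀ X, ξ 0 X = X) (hξ : ∀ X t, HasDerivAt (fun s => ξ s X) (V (ξ t X)) t)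
    (t₀ : ℝ) (X : Fin N → ℝ) :
    Set.range (fun t => ξ (t - t₀) X) = Set.range (fun σ => φ σ X) := by
  ext Y
  constructor
  · rintro ⟨t, rfl⟩
    obtain ⟨σ, hσ⟩ := hφ.time_surjective h X (t - t₀)
    exact ⟨σ, by simp only at hσ ⊢; rw [← hφ.flow_time' h hξ0 hξ σ X, hσ]⟩
  · rintro ⟨σ, rfl⟩
    exact ⟨A σ X + t₀, by simp [hφ.flow_time' h hξ0 hξ]⟩

theorem flow_add_period (h : ContractingField V o w b lam c M L) (hφ : SectionFlow V o φ A)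
    (hξ0 : ∀ X, ξ 0 X = X) (hξ : ∀ X t, HasDerivAt (fun s => ξ s X) (V (ξ t X)) t)
    (hX₀ : φ 1 X₀ = X₀ + 1) (t : ℝ) : ξ (t + A 1 X₀) X₀ = ξ t X₀ + 1 := by
  refine congrFun (ODE_solution_unique_univ (v := fun _ => V) (s := fun _ => Set.univ) (t₀ := 0)
    (f := fun t => ξ (t + A 1 X₀) X₀) (g := fun t => ξ t X₀ + 1)
    (fun _ => h.lipschitzWith.lipschitzOnWith)
    (fun t => ⟨(hξ X₀ (t + A 1 X₀)).comp_add_const t _, trivial⟩)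
    (fun t => ⟨by simpa [h.periodic (ξ t X₀)] using (hξ X₀ t).add_const (1 : Fin N → ℝ), trivial⟩)
    ?_) t
  simp [hξ0, hφ.flow_time' h hξ0 hξ, hX₀]

theorem isOpen_sectionTube (h : ContractingField V o w b lam c M L) :
    IsOpen (sectionTube o w) := by
  have hwc : Continuous w := continuous_iff_continuousAt.2 fun s => (h.w_deriv s).continuousAt
  have hd : Continuous (diag N) := continuous_iff_continuousAt.2 fun s =>
    (hasDerivAt_diag N s).continuousAt
  exact isOpen_lt (by fun_prop) (by fun_prop)

theorem fixed_mem_sectionTube (h : ContractingField V o w b lam c M L)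
    (hφ : SectionFlow V o φ A) (h0 : X₀ o = 0) (hw : ‖X₀‖ ≤ w 0 / 2) (hX₀ : φ 1 X₀ = X₀ + 1)
    (σ : ℝ) : φ σ X₀ ∈ sectionTube o w := by
  have h1 := hφ.fixed_norm_sub_diag_le h h0 hw hX₀ σ
  have h2 : φ σ X₀ o = σ := by rw [hφ.apply_self h, h0, zero_add]
  have := h.w_pos σ
  simp only [sectionTube, Set.mem_ofPred_eq, h2]
  linarith

-- The orbit is not compact, but it is so modulo integer translations along the diagonal: one period
-- yields a `δ` valid everywhere.
open Metric in
theorem exists_thickening_subset (h : ContractingField V o w b lam c M L)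
    (hφ : SectionFlow V o φ A) (h0 : X₀ o = 0) (hw : ‖X₀‖ ≤ w 0 / 2) (hX₀ : φ 1 X₀ = X₀ + 1) :
    ∃ δ > 0, ∀ X σ, dist X (φ σ X₀) < δ → X ∈ sectionTube o w := by
  have hc : Continuous (fun σ => φ σ X₀) := continuous_iff_continuousAt.2 fun σ =>
    (hφ.hasDerivAt σ X₀).continuousAt
  obtain ⟨δ, hδ, hsub⟩ := (isCompact_Icc.image (s := Set.Icc (0 : ℝ) 1) hc).exists_thickening_subset_open
    (isOpen_sectionTube h) (by rintro _ ⟨σ, -, rfl⟩; exact hφ.fixed_mem_sectionTube h h0 hw hX₀ σ)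
  refine ⟨δ, hδ, fun X σ hX => ?_⟩
  have hper : Function.Periodic (fun σ => φ σ X₀ - diag N σ) 1 := fun σ => by
    simp only [hφ.fixed_add_one h hX₀, diag_add, diag_one, add_sub_add_right_eq_sub]
  have hfl : σ - (⌊σ⌋ : ℝ) = Int.fract σ := Int.self_sub_floor σ
  have h1 : φ (Int.fract σ) X₀ = φ σ X₀ - diag N ⌊σ⌋ := by
    have h2 := hper.sub_zsmul_eq (x := σ) ⌊σ⌋
    rw [zsmul_one, hfl] at h2
    have h3 : diag N (Int.fract σ) = diag N σ - diag N ⌊σ⌋ := by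
      rw [← hfl]; rfl
    rw [h3, sub_eq_sub_iff_add_eq_add] at h2
    rw [eq_sub_iff_add_eq]
    ext i
    have := congrFun h2 i
    simp only [Pi.add_apply, Pi.sub_apply, diag_apply] at this ⊢
    linarith
  have h4 : X - diag N ⌊σ⌋ ∈ sectionTube o w := by
    apply hsub
    rw [mem_thickening_iff]
    refine ⟨φ (Int.fract σ) X₀, ⟨_, ⟨Int.fract_nonneg σ, (Int.fract_lt_one σ).le⟩, rfl⟩, ?_⟩
    rw [h1, dist_sub_right]; exact hX
  have h5 : w (X o - ⌊σ⌋) = w (X o) := by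
    have := h.w_periodic.sub_zsmul_eq (x := X o) ⌊σ⌋
    rwa [zsmul_one] at this
  have h6 : X - diag N ⌊σ⌋ - diag N (X o - ⌊σ⌋) = X - diag N (X o) := by
    ext i; simp [diag_apply]
  simpa [sectionTube, diag_apply, h5, h6] using h4

/-- Orbital asymptotic stability of the periodic orbit. -/
theorem isOrbitallyAsymptoticallyStable (h : ContractingField V o w b lam c M L)
    (hφ : SectionFlow V o φ A) (hξ0 : ∀ X, ξ 0 X = X)
    (hξ : ∀ X t, HasDerivAt (fun s => ξ s X) (V (ξ t X)) t) (t₀ : ℝ)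
    (h0 : X₀ o = 0) (hw : ‖X₀‖ ≤ w 0 / 2) (hX₀ : φ 1 X₀ = X₀ + 1) :
    IsOrbitallyAsymptoticallyStable V t₀ (Set.range (fun σ => φ σ X₀)) := by
  obtain ⟨δ₀, hδ₀, hsub⟩ := hφ.exists_thickening_subset h h0 hw hX₀
  obtain ⟨C, hC, hcon⟩ := hφ.exists_uniform_norm_sub_le h
  set Γ := Set.range (fun σ => φ σ X₀)
  have hne : Γ.Nonempty := Set.range_nonempty _
  obtain ⟨m, hm, hKlip⟩ : ∃ m > 0, ∀ s t, ‖φ s X₀ - φ t X₀‖ ≤ m * |s - t| := by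
    refine ⟨c⁻¹ * M, mul_pos (inv_pos.2 h.c_pos) h.bound_pos, fun s t => ?_⟩
    refine Convex.norm_image_sub_le_of_norm_hasDerivWithin_le (s := Set.univ)
      (fun t _ => (hφ.hasDerivAt t X₀).hasDerivWithinAt) (fun t _ => ?_) convex_univ trivial trivial
    rw [norm_smul, Real.norm_of_nonneg (inv_pos.2 (h.apply_pos _)).le]
    have := h.inv_apply_le (φ t X₀)
    have := h.norm_le (φ t X₀)
    have := h.bound_pos
    have := inv_pos.2 h.c_pos
    gcongr
  have key : ∀ x : ℝ → Fin N → ℝ, IsForwardSolution V t₀ x → ∀ δ ≤ δ₀,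
      Metric.infDist (x t₀) Γ < δ → ∀ t, t₀ ≤ t →
      Metric.infDist (x t) Γ ≤ C * (1 + m) * δ * Real.exp (-(lam / 2 * c) * (t - t₀)) := by
    intro x hx δ hδ hd t ht
    obtain ⟨_, ⟨s, rfl⟩, hs⟩ := (Metric.infDist_lt_iff hne).1 hd
    simp only at hs
    set X := x t₀
    have hXt : x t = ξ (t - t₀) X := by
      refine eqOn_Ici_of_isIntegralCurveOn h.contDiff hx (y := fun t => ξ (t - t₀) X)
        (fun t _ => ((hξ X (t - t₀)).comp_sub_const t t₀).hasDerivWithinAt) ?_ ht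
      simp [hξ0, X]
    obtain ⟨σ, hσ, hσ0, hσc⟩ := hφ.exists_time_eq h X (sub_nonneg.2 ht)
    have hXmem := hsub X s (hs.trans_le hδ)
    -- The comparison point on the orbit is the one in the same section as `X`, not the nearest one.
    -- This costs the factor `1 + m`, with `m` the Lipschitz constant of the orbit.
    have hYo : φ (X o) X₀ o = X o := by rw [hφ.apply_self h, h0, zero_add]
    have hYmem := hφ.fixed_mem_sectionTube h h0 hw hX₀ (X o)
    have h1 := hcon X (φ (X o) X₀) hYo.symm hXmem.le hYmem.le σ hσ0
    have h2 : φ σ (φ (X o) X₀) ∈ Γ := ⟨σ + X o, (hφ.pair_add h σ (X o) X₀).1⟩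
    have h3 : ‖X - φ (X o) X₀‖ ≤ (1 + m) * δ := by
      have hso : φ s X₀ o = s := by rw [hφ.apply_self h, h0, zero_add]
      have h4 : |s - X o| ≤ δ := by
        rw [abs_sub_comm, ← hso, ← Real.norm_eq_abs, hso]
        have := norm_le_pi_norm (X - φ s X₀) o
        rw [Pi.sub_apply, hso] at this
        rw [dist_eq_norm] at hs
        linarith
      have h5 := hKlip s (X o)
      have h6 := norm_sub_le_norm_sub_add_norm_sub X (φ s X₀) (φ (X o) X₀)
      rw [dist_eq_norm] at hs
      nlinarith
    have hl := h.lam_pos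
    calc Metric.infDist (x t) Γ ≤ dist (x t) (φ σ (φ (X o) X₀)) := Metric.infDist_le_dist_of_mem h2
      _ = ‖φ σ X - φ σ (φ (X o) X₀)‖ := by
        rw [hXt, ← hσ, hφ.flow_time' h hξ0 hξ, dist_eq_norm]
      _ ≤ C * Real.exp (-(lam / 2 * σ)) * ((1 + m) * δ) := h1.trans (by gcongr)
      _ ≤ C * Real.exp (-(lam / 2 * c) * (t - t₀)) * ((1 + m) * δ) := by
        have hδ' : 0 ≤ δ := Metric.infDist_nonneg.trans hd.le
        gcongr
        nlinarith
      _ = _ := by ring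
  refine ⟨⟨δ₀, hδ₀, fun X _ => ⟨fun t => ξ (t - t₀) X, by simp [hξ0], fun t _ =>
    ((hξ X (t - t₀)).comp_sub_const t t₀).hasDerivWithinAt⟩, fun x hx hd => ?_⟩, fun ε hε => ?_⟩
  · refine squeeze_zero' (Filter.Eventually.of_forall fun t => Metric.infDist_nonneg)
      ((Filter.eventually_ge_atTop t₀).mono fun t ht => key x hx δ₀ le_rfl hd t ht) ?_
    rw [← mul_zero (C * (1 + m) * δ₀)]
    refine Filter.Tendsto.const_mul _ (Real.tendsto_exp_atBot.comp ?_)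
    have hneg : -(lam / 2 * c) < 0 := by
      have := mul_pos (half_pos h.lam_pos) h.c_pos
      linarith
    exact (Filter.tendsto_atTop_add_const_right _ (-t₀) Filter.tendsto_id).const_mul_atTop_of_neg
      hneg
  · refine ⟨min δ₀ (ε / (2 * (C * (1 + m)))), by positivity, fun x hx hd t ht => ?_⟩
    refine (key x hx _ (min_le_left _ _) hd t ht).trans_lt ?_
    have h1 : Real.exp (-(lam / 2 * c) * (t - t₀)) ≤ 1 := by
      rw [← Real.exp_zero]
      have := mul_pos (half_pos h.lam_pos) h.c_pos
      exact Real.exp_le_exp.2 (by nlinarith)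
    calc _ ≤ C * (1 + m) * (ε / (2 * (C * (1 + m)))) * 1 := by
          gcongr; exact min_le_right _ _
      _ = ε / 2 := by field_simp
      _ < ε := by linarith

end SectionFlow

end MeanField

/-! ### Asymptotic phase, the stable fibre and the locked orbit. -/

namespace MeanField

variable {N : ℕ} {V : (Fin N → ℝ) → (Fin N → ℝ)} {o : Fin N} {w b : ℝ → ℝ} {lam c M L : ℝ}
  {φ : ℝ → (Fin N → ℝ) → (Fin N → ℝ)} {A : ℝ → (Fin N → ℝ) → ℝ} {X₀ : Fin N → ℝ}
  {ξ : ℝ → (Fin N → ℝ) → (Fin N → ℝ)}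

/-- The projection along the flow to the section `X o = 0`. -/
def toSection (φ : ℝ → (Fin N → ℝ) → (Fin N → ℝ)) (o : Fin N) (X : Fin N → ℝ) : Fin N → ℝ :=
  φ (-(X o)) X

/-- The deviation of the `n`-th return time from the period. -/
def returnTimeDev (φ : ℝ → (Fin N → ℝ) → (Fin N → ℝ)) (A : ℝ → (Fin N → ℝ) → ℝ) (o : Fin N)
    (X₀ : Fin N → ℝ) (n : ℕ) (X : Fin N → ℝ) : ℝ :=
  A 1 (φ n (toSection φ o X)) - A 1 X₀

/-- The asymptotic phase. -/
noncomputable def phase (φ : ℝ → (Fin N → ℝ) → (Fin N → ℝ)) (A : ℝ → (Fin N → ℝ) → ℝ) (o : Fin N)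
    (X₀ : Fin N → ℝ) (X : Fin N → ℝ) : ℝ :=
  A (-(X o)) X + ∑' n, returnTimeDev φ A o X₀ n X

namespace SectionFlow

theorem toSection_contDiff (hφ : SectionFlow V o φ A) : ContDiff ℝ 1 (toSection φ o) :=
  hφ.contDiff.comp (((contDiff_apply ℝ ℝ o).neg).prodMk contDiff_id)

theorem toSection_apply (h : ContractingField V o w b lam c M L) (hφ : SectionFlow V o φ A)
    (X : Fin N → ℝ) : toSection φ o X o = 0 := by
  rw [toSection, hφ.apply_self h, add_neg_cancel]

theorem toSection_fixed (hφ : SectionFlow V o φ A) (h0 : X₀ o = 0) : toSection φ o X₀ = X₀ := by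
  rw [toSection, h0, neg_zero, hφ.zero]

theorem toSection_flow (h : ContractingField V o w b lam c M L) (hφ : SectionFlow V o φ A)
    (h0 : X₀ o = 0) (σ : ℝ) : toSection φ o (φ σ X₀) = X₀ := by
  rw [toSection, hφ.apply_self h, h0, zero_add, ← (hφ.pair_add h _ _ _).1, neg_add_cancel, hφ.zero]

theorem time_one_contDiff (hφ : SectionFlow V o φ A) : ContDiff ℝ 1 (A 1) :=
  hφ.time_contDiff.comp (contDiff_const.prodMk contDiff_id)

theorem returnTimeDev_contDiff (hφ : SectionFlow V o φ A) (n : ℕ) :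
    ContDiff ℝ 1 (returnTimeDev φ A o X₀ n) :=
  (hφ.time_one_contDiff.comp (hφ.contDiff.comp
    (contDiff_const.prodMk hφ.toSection_contDiff))).sub contDiff_const

theorem returnTimeDev_of_toSection (h : ContractingField V o w b lam c M L)
    (hφ : SectionFlow V o φ A) (hX₀ : φ 1 X₀ = X₀ + 1) (n : ℕ) {X : Fin N → ℝ}
    (hX : toSection φ o X = X₀) : returnTimeDev φ A o X₀ n X = 0 := by
  rw [returnTimeDev, hX, (hφ.fixed_nat h hX₀ n).2, sub_self]

/-- On the periodic orbit every return takes exactly one period, so the series vanishes. The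
resulting monotone phase supplies the nonzero derivative needed for the submanifold. -/
theorem phase_flow (h : ContractingField V o w b lam c M L) (hφ : SectionFlow V o φ A)
    (h0 : X₀ o = 0) (hX₀ : φ 1 X₀ = X₀ + 1) (σ : ℝ) : phase φ A o X₀ (φ σ X₀) = -A σ X₀ := by
  have h1 : ∀ n, returnTimeDev φ A o X₀ n (φ σ X₀) = 0 := fun n =>
    hφ.returnTimeDev_of_toSection h hX₀ n (hφ.toSection_flow h h0 σ)
  have h2 := (hφ.pair_add h (-σ) σ X₀).2
  rw [neg_add_cancel, hφ.time_zero] at h2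
  rw [phase, tsum_congr h1, tsum_zero, add_zero, hφ.apply_self h, h0, zero_add]
  linarith

/-- Near the periodic orbit the return times converge geometrically, and the phase is `C¹`. -/
theorem exists_phase_ball (h : ContractingField V o w b lam c M L) (hφ : SectionFlow V o φ A)
    (h0 : X₀ o = 0) (hw : ‖X₀‖ ≤ w 0 / 2) (hX₀ : φ 1 X₀ = X₀ + 1) :
    ∃ r > 0, Metric.ball X₀ r ⊆ sectionTube o w ∧
      ContDiffOn ℝ 1 (phase φ A o X₀) (Metric.ball X₀ r) ∧
      ∃ C, 0 ≤ C ∧ ∀ X ∈ Metric.ball X₀ r, ∀ n : ℕ,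
        |returnTimeDev φ A o X₀ n X| ≤ C * Real.exp (-(lam / 2)) ^ n ∧
        ‖φ n (toSection φ o X) - φ n X₀‖ ≤ C * Real.exp (-(lam / 2)) ^ n := by
  obtain ⟨C, hC, hcon⟩ := hφ.exists_uniform_norm_sub_le h
  obtain ⟨C₁, hC₁, hA⟩ := hφ.exists_time_lipschitz h
  obtain ⟨Lq, t, ht, hLq⟩ := (hφ.toSection_contDiff).contDiffAt (x := X₀) |>.exists_lipschitzOnWith
  have hw0 := h.w_pos 0
  have hmem0 : X₀ ∈ sectionTube o w := by
    simpa [hφ.zero] using hφ.fixed_mem_sectionTube h h0 hw hX₀ 0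
  -- On this neighbourhood the projection to the section is Lipschitz and lands inside the tube,
  -- where the contraction applies.
  have hev : ∀ᶠ X in 𝓝 X₀, X ∈ t ∧ X ∈ sectionTube o w ∧ ‖toSection φ o X‖ < w 0 := by
    refine Filter.Eventually.and ht (Filter.Eventually.and
      ((isOpen_sectionTube h).mem_nhds hmem0) ?_)
    refine (hφ.toSection_contDiff.continuous.norm.tendsto X₀).eventually (gt_mem_nhds ?_)
    rw [hφ.toSection_fixed h0]; linarith
  obtain ⟨r, hr, hball⟩ := Metric.eventually_nhds_iff_ball.1 hev
  have hX₀b : X₀ ∈ Metric.ball X₀ r := Metric.mem_ball_self hr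
  set κ := Real.exp (-(lam / 2))
  have hκ0 : 0 < κ := Real.exp_pos _
  have hκ1 : κ < 1 :=
    (Real.exp_lt_exp.2 (show _ < (0 : ℝ) by linarith [h.lam_pos])).trans_eq Real.exp_zero
  have hflow : ∀ X ∈ Metric.ball X₀ r, ∀ Y ∈ Metric.ball X₀ r, ∀ n : ℕ,
      ‖φ n (toSection φ o X) - φ n (toSection φ o Y)‖ ≤ C * Lq * κ ^ n * ‖X - Y‖ := by
    intro X hX Y hY n
    have hin : ∀ Z ∈ Metric.ball X₀ r,
        ‖toSection φ o Z - diag N (toSection φ o Z o)‖ ≤ w (toSection φ o Z o) := fun Z hZ => by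
      rw [hφ.toSection_apply h, diag_zero, sub_zero]; exact (hball Z hZ).2.2.le
    have h1 := hcon _ _ ((hφ.toSection_apply h X).trans (hφ.toSection_apply h Y).symm)
      (hin X hX) (hin Y hY) n n.cast_nonneg
    have h2 := hLq.dist_le_mul X (hball X hX).1 Y (hball Y hY).1
    rw [dist_eq_norm, dist_eq_norm] at h2
    have h3 : Real.exp (-(lam / 2 * n)) = κ ^ n := by
      rw [← Real.exp_nat_mul]; ring_nf
    rw [h3] at h1
    calc _ ≤ C * κ ^ n * (Lq * ‖X - Y‖) := h1.trans (by gcongr)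
      _ = _ := by ring
  have hdev : ∀ n : ℕ, ∀ X ∈ Metric.ball X₀ r, ∀ Y ∈ Metric.ball X₀ r,
      |returnTimeDev φ A o X₀ n X - returnTimeDev φ A o X₀ n Y| ≤
        C₁ * (C * Lq) * κ ^ n * ‖X - Y‖ := by
    intro n X hX Y hY
    rw [returnTimeDev, returnTimeDev, sub_sub_sub_cancel_right]
    calc _ ≤ C₁ * (C * Lq * κ ^ n * ‖X - Y‖) :=
          (hA _ _).trans (mul_le_mul_of_nonneg_left (hflow X hX Y hY n) hC₁)
      _ = _ := by ring
  have hzero : ∀ n, returnTimeDev φ A o X₀ n X₀ = 0 := fun n =>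
    hφ.returnTimeDev_of_toSection h hX₀ n (hφ.toSection_fixed h0)
  -- `C₁ + 1` dominates both `C₁`, for the return times, and `1`, for the positions.
  refine ⟨r, hr, fun X hX => (hball X hX).2.1, ?_, (C₁ + 1) * (C * Lq) * r, by positivity,
    fun X hX n => ?_⟩
  · refine ContDiffOn.add (hφ.time_contDiff.comp
      (((contDiff_apply ℝ ℝ o).neg).prodMk contDiff_id)).contDiffOn ?_
    exact contDiffOn_one_tsum_of_lipschitz Metric.isOpen_ball (convex_ball _ _)
      ((summable_geometric_of_lt_one hκ0.le hκ1).mul_left _) (fun n => by positivity)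
      (fun n => hφ.returnTimeDev_contDiff n) hdev hX₀b hzero
  · have hXr : ‖X - X₀‖ ≤ r := by rw [← dist_eq_norm]; exact (Metric.mem_ball.1 hX).le
    have hCL : 0 ≤ C * Lq := by positivity
    have hκn : 0 ≤ κ ^ n := by positivity
    constructor
    · have h1 := hdev n X hX X₀ hX₀b
      rw [hzero, sub_zero] at h1
      calc _ ≤ C₁ * (C * Lq) * κ ^ n * r := h1.trans (by gcongr)
        _ ≤ (C₁ + 1) * (C * Lq) * κ ^ n * r := by gcongr; linarith
        _ = _ := by ring
    · have h1 := hflow X hX X₀ hX₀b n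
      rw [hφ.toSection_fixed h0] at h1
      calc _ ≤ 1 * (C * Lq) * κ ^ n * r := h1.trans (by rw [one_mul]; gcongr)
        _ ≤ (C₁ + 1) * (C * Lq) * κ ^ n * r := by gcongr; linarith
        _ = _ := by ring

/-- The fibre of the phase is a submanifold. -/
theorem exists_isC1Submanifold (h : ContractingField V o w b lam c M L) (hφ : SectionFlow V o φ A)
    (h0 : X₀ o = 0) (hX₀ : φ 1 X₀ = X₀ + 1) {r : ℝ} (hr : 0 < r)
    (hg : ContDiffOn ℝ 1 (phase φ A o X₀) (Metric.ball X₀ r)) :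
    ∃ W ⊆ Metric.ball X₀ r, X₀ ∈ W ∧ (∀ X ∈ W, phase φ A o X₀ X = 0) ∧
      IsC1Submanifold (N - 1) W := by
  set g := phase φ A o X₀
  have hX₀b : X₀ ∈ Metric.ball X₀ r := Metric.mem_ball_self hr
  have hg0 : g X₀ = 0 := by
    have := hφ.phase_flow h h0 hX₀ 0
    rwa [hφ.zero, hφ.time_zero, neg_zero] at this
  set v := (V X₀ o)⁻¹ • V X₀
  have hv : fderiv ℝ g X₀ v = -(V X₀ o)⁻¹ := by
    have h1 : HasFDerivAt g (fderiv ℝ g X₀) (φ 0 X₀) := by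
      rw [hφ.zero]
      exact ((hg.contDiffAt (Metric.isOpen_ball.mem_nhds hX₀b)).differentiableAt
        one_ne_zero).hasFDerivAt
    have h2 := h1.comp_hasDerivAt 0 (hφ.hasDerivAt 0 X₀)
    have h3 : g ∘ (fun s => φ s X₀) = fun s => -A s X₀ := by
      ext s; exact hφ.phase_flow h h0 hX₀ s
    rw [h3, hφ.zero] at h2
    have h4 := (hφ.time_hasDerivAt 0 X₀).neg
    rw [hφ.zero] at h4
    exact h2.unique h4
  have hcont : ContinuousOn (fun X => fderiv ℝ g X v) (Metric.ball X₀ r) :=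
    (hg.continuousOn_fderiv_of_isOpen Metric.isOpen_ball le_rfl).clm_apply continuousOn_const
  -- The ball is cut down to where the phase still varies in the fixed direction `v`, so that it is
  -- a submersion on all of `U`.
  set U := Metric.ball X₀ r ∩ (fun X => fderiv ℝ g X v) ⁻¹' {0}ᶜ
  have hU : IsOpen U := hcont.isOpen_inter_preimage Metric.isOpen_ball isOpen_compl_singleton
  refine ⟨{X ∈ U | g X = 0}, fun X hX => hX.1.1, ⟨⟨hX₀b, ?_⟩, hg0⟩, fun X hX => hX.2, 1, ?_,
    fun p hp => ⟨U, hU, hp.1, fun X _ => g X, ?_, fun y hy => ?_, ?_⟩⟩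
  · change fderiv ℝ g X₀ v ≠ 0
    rw [hv]
    exact neg_ne_zero.2 (inv_ne_zero (h.apply_pos X₀).ne')
  · have := o.pos
    omega
  · exact contDiffOn_pi.2 fun _ => hg.mono Set.inter_subset_left
  · have hd : DifferentiableAt ℝ g y :=
      (hg.contDiffAt (Metric.isOpen_ball.mem_nhds hy.1)).differentiableAt one_ne_zero
    have h1 : HasFDerivAt (fun X => (fun _ => g X : Fin 1 → ℝ))
        (ContinuousLinearMap.pi fun _ => fderiv ℝ g y) y := hasFDerivAt_pi.2 fun _ => hd.hasFDerivAt
    rw [h1.fderiv]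
    intro z
    have hne : fderiv ℝ g y v ≠ 0 := hy.2
    refine ⟨(z 0 / fderiv ℝ g y v) • v, ?_⟩
    ext i
    rw [Subsingleton.elim i 0]
    simp [hne]
  · ext X
    constructor
    · rintro ⟨h1, h2⟩
      exact ⟨h2, by ext; exact h1.2⟩
    · rintro ⟨h1, h2⟩
      exact ⟨⟨h1, congrFun h2 0⟩, h1⟩

/-- Points of phase zero are exponentially attracted with asymptotic phase. -/
theorem exists_exp_attraction (h : ContractingField V o w b lam c M L) (hφ : SectionFlow V o φ A)
    (hξ0 : ∀ X, ξ 0 X = X) (hξ : ∀ X t, HasDerivAt (fun s => ξ s X) (V (ξ t X)) t)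
    (hX₀ : φ 1 X₀ = X₀ + 1) {C : ℝ} (hC : 0 ≤ C) :
    ∃ β > 0, ∃ K > 0, ∀ X, phase φ A o X₀ X = 0 →
      (∀ n : ℕ, |returnTimeDev φ A o X₀ n X| ≤ C * Real.exp (-(lam / 2)) ^ n ∧
        ‖φ n (toSection φ o X) - φ n X₀‖ ≤ C * Real.exp (-(lam / 2)) ^ n) →
      ∀ t, 0 ≤ t → ‖ξ t X - ξ t X₀‖ < K * Real.exp (-β * t) := by
  set T := A 1 X₀
  have hT : 0 < T := hφ.period_pos h X₀
  have hl := h.lam_pos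
  set κ := Real.exp (-(lam / 2))
  have hκ0 : 0 < κ := Real.exp_pos _
  have hκ1 : κ < 1 := (Real.exp_lt_exp.2 (show _ < (0 : ℝ) by linarith)).trans_eq Real.exp_zero
  have hM := h.bound_pos
  set C' := M * (C * (1 - κ)⁻¹) + C
  have hC' : 0 ≤ C' := by
    have : 0 < 1 - κ := by linarith
    positivity
  -- The deviation shrinks by `exp (-lam / 2)` per period `T`. The two exponentials in `K` pay for
  -- the flow within a period and for rounding `t` down; `+ 1` makes the bound strict even if `C' =
  -- 0`.
  refine ⟨lam / (2 * T), by positivity, C' * Real.exp (L.toNNReal * T) * Real.exp (lam / 2) + 1,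
    by positivity, fun X hX hdev t ht => ?_⟩
  have hgeo := summable_geometric_of_lt_one hκ0.le hκ1
  have hsum : Summable (fun n => returnTimeDev φ A o X₀ n X) :=
    Summable.of_norm_bounded (hgeo.mul_left C) fun n => (hdev n).1
  have hnat : ∀ n : ℕ, ‖ξ (n * T) X - ξ (n * T) X₀‖ ≤ C' * κ ^ n := by
    intro n
    -- `a` is the time at which the orbit of `X` meets the section `n`. Phase zero says that `n * T
    -- - a` is exactly the tail of the series, hence geometrically small.
    set a := A (n + -(X o)) X
    have h1 : a = n * T - ∑' k, returnTimeDev φ A o X₀ (k + n) X := by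
      have h2 : a = A n (toSection φ o X) + A (-(X o)) X := (hφ.pair_add h n (-(X o)) X).2
      have h3 := hsum.sum_add_tsum_nat_add n
      have h4 : ∑ k ∈ Finset.range n, returnTimeDev φ A o X₀ k X = A n (toSection φ o X) - n * T := by
        rw [hφ.time_nat h]
        simp [returnTimeDev, T]
      rw [phase] at hX
      linarith
    have h2 : |n * T - a| ≤ C * (1 - κ)⁻¹ * κ ^ n := by
      rw [h1, sub_sub_cancel, ← Real.norm_eq_abs]
      have h3 := (hgeo.mul_left C).mul_left (κ ^ n)
      refine (tsum_of_norm_bounded h3.hasSum fun k => ?_).trans (le_of_eq ?_)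
      · have := (hdev (k + n)).1
        rw [Real.norm_eq_abs]
        calc _ ≤ _ := this
          _ = _ := by ring
      · rw [tsum_mul_left, tsum_mul_left, tsum_geometric_of_lt_one hκ0.le hκ1]; ring
    have h3 : ξ a X = φ n (toSection φ o X) := by
      rw [hφ.flow_time' h hξ0 hξ, (hφ.pair_add h n (-(X o)) X).1]; rfl
    have h4 : ξ (n * T) X₀ = φ n X₀ := by
      rw [← hφ.fixed_time_nat h hX₀, hφ.flow_time' h hξ0 hξ]
    have h5 : ‖ξ (n * T) X - ξ a X‖ ≤ M * ‖n * T - a‖ :=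
      Convex.norm_image_sub_le_of_norm_hasDerivWithin_le (s := Set.univ)
        (fun t _ => (hξ X t).hasDerivWithinAt) (fun t _ => h.norm_le _) convex_univ trivial trivial
    calc _ ≤ ‖ξ (n * T) X - ξ a X‖ + ‖ξ a X - ξ (n * T) X₀‖ := norm_sub_le_norm_sub_add_norm_sub ..
      _ ≤ M * (C * (1 - κ)⁻¹ * κ ^ n) + C * κ ^ n := by
        refine add_le_add (h5.trans ?_) ?_
        · rw [Real.norm_eq_abs]; gcongr
        · rw [h3, h4]; exact (hdev n).2
      _ = _ := by ring
  set n := ⌊t / T⌋₊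
  have hn1 : (n : ℝ) * T ≤ t := by
    rw [← le_div_iff₀ hT]; exact Nat.floor_le (by positivity)
  have hn2 : t ≤ (n + 1) * T := by
    rw [← div_le_iff₀ hT]; exact (Nat.lt_floor_add_one _).le
  have hcξ : ∀ X, Continuous (fun s => ξ s X) := fun X =>
    continuous_iff_continuousAt.2 fun s => (hξ X s).continuousAt
  have h1 := dist_le_of_trajectories_ODE (v := fun _ => V) (a := n * T) (b := t)
    (fun _ => h.lipschitzWith) (hcξ X).continuousOn (fun s _ => (hξ X s).hasDerivWithinAt)
    (hcξ X₀).continuousOn (fun s _ => (hξ X₀ s).hasDerivWithinAt)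
    ((dist_eq_norm _ _).trans_le (hnat n)) t ⟨hn1, le_rfl⟩
  rw [dist_eq_norm] at h1
  have h2 : κ ^ n ≤ Real.exp (lam / 2) * Real.exp (-(lam / (2 * T)) * t) := by
    rw [← Real.exp_nat_mul, ← Real.exp_add, Real.exp_le_exp]
    have h3 : lam / (2 * T) * t ≤ lam / (2 * T) * ((n + 1) * T) := by gcongr
    have h4 : lam / (2 * T) * ((n + 1) * T) = lam / 2 * (n + 1) := by field_simp
    linarith
  have h3 : Real.exp (L.toNNReal * (t - n * T)) ≤ Real.exp (L.toNNReal * T) := by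
    gcongr; linarith
  have h4 := Real.exp_pos (-(lam / (2 * T)) * t)
  calc _ ≤ C' * κ ^ n * Real.exp (L.toNNReal * (t - n * T)) := h1
    _ ≤ C' * (Real.exp (lam / 2) * Real.exp (-(lam / (2 * T)) * t)) *
        Real.exp (L.toNNReal * T) := by gcongr
    _ < (C' * Real.exp (L.toNNReal * T) * Real.exp (lam / 2) + 1) *
        Real.exp (-(lam / (2 * T)) * t) := by linarith

end SectionFlow

/-- Existence of the phase-locked orbit, of its stable fibre and orbital stability, for a
contracting field. -/
theorem ContractingField.exists_lockedOrbit (h : ContractingField V o w b lam c M L) (t₀ : ℝ) :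
    ∃ (W : Set (Fin N → ℝ)) (ρ : ℝ) (Ψ : ℝ → Fin N → ℝ),
      W ⊆ sectionTube o w ∧ IsC1Submanifold (N - 1) W ∧ 0 < ρ ∧ ContDiff ℝ 1 Ψ ∧
      Function.Periodic Ψ (1 / ρ) ∧ IsForwardSolution V t₀ (lockedOrbit ρ Ψ) ∧
      lockedOrbit ρ Ψ t₀ ∈ W ∧
      (∃ β : ℝ, 0 < β ∧ ∃ K : ℝ, 0 < K ∧ ∀ x : ℝ → Fin N → ℝ,
        IsForwardSolution V t₀ x → x t₀ ∈ W → ∀ t, t₀ ≤ t →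
          ‖x t - lockedOrbit ρ Ψ t‖ < K * Real.exp (-β * (t - t₀))) ∧
      (∃ δ > 0, ∀ X, Metric.infDist X (Set.range (lockedOrbit ρ Ψ)) < δ → X ∈ sectionTube o w) ∧
      IsOrbitallyAsymptoticallyStable V t₀ (Set.range (lockedOrbit ρ Ψ)) := by
  obtain ⟨φ, A, hφ⟩ := h.exists_sectionFlow
  obtain ⟨ξ, hξ0, hξ⟩ := h.exists_flow
  obtain ⟨X₀, h0, hw, hX₀⟩ := hφ.exists_fixedPoint h
  obtain ⟨r, hr, hsub, hg, C, hC, hdev⟩ := hφ.exists_phase_ball h h0 hw hX₀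
  obtain ⟨W, hWr, hX₀W, hW0, hWman⟩ := hφ.exists_isC1Submanifold h h0 hX₀ hr hg
  obtain ⟨β, hβ, K, hK, hatt⟩ := hφ.exists_exp_attraction h hξ0 hξ hX₀ hC
  have hT : 0 < A 1 X₀ := hφ.period_pos h X₀
  set ρ := (A 1 X₀)⁻¹
  -- Over one period `1 / ρ` both terms advance by `𝟙`, so the difference is periodic.
  set Ψ : ℝ → Fin N → ℝ := fun t => ξ (t - t₀) X₀ - diag N (ρ * t)
  have hlock : lockedOrbit ρ Ψ = fun t => ξ (t - t₀) X₀ := by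
    ext t i; simp [lockedOrbit, Ψ]
  have hsol : ∀ X t, HasDerivAt (fun t => ξ (t - t₀) X) (V (ξ (t - t₀) X)) t := fun X t =>
    (hξ X (t - t₀)).comp_sub_const t t₀
  have hlock0 : lockedOrbit ρ Ψ t₀ = X₀ := by rw [hlock]; simp [hξ0]
  have hrange : Set.range (lockedOrbit ρ Ψ) = Set.range (fun σ => φ σ X₀) := by
    rw [hlock, hφ.range_flow h hξ0 hξ]
  refine ⟨W, ρ, Ψ, hWr.trans hsub, hWman, inv_pos.2 hT, ?_, ?_, ?_, by rwa [hlock0],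
    ⟨β, hβ, K, hK, ?_⟩, ?_, ?_⟩
  · refine ContDiff.sub ?_ ?_
    · rw [contDiff_one_iff_deriv]
      refine ⟨fun t => (hsol X₀ t).differentiableAt, ?_⟩
      have h1 : deriv (fun t => ξ (t - t₀) X₀) = fun t => V (ξ (t - t₀) X₀) :=
        funext fun t => (hsol X₀ t).deriv
      rw [h1]
      exact h.contDiff.continuous.comp
        (continuous_iff_continuousAt.2 fun t => (hsol X₀ t).continuousAt)
    · exact contDiff_pi.2 fun i => contDiff_const.mul contDiff_id
  · intro t
    have h1 : 1 / ρ = A 1 X₀ := by simp [ρ]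
    have h2 : t + A 1 X₀ - t₀ = t - t₀ + A 1 X₀ := by ring
    have h3 : ρ * (t + A 1 X₀) = ρ * t + 1 := by simp only [ρ]; field_simp
    simp only [Ψ]
    rw [h1, h2, hφ.flow_add_period h hξ0 hξ hX₀, h3, diag_add, diag_one, add_sub_add_right_eq_sub]
  · rw [hlock]
    exact fun t _ => (hsol X₀ t).hasDerivWithinAt
  · intro x hx hxW t ht
    have hxt : x t = ξ (t - t₀) (x t₀) :=
      eqOn_Ici_of_isIntegralCurveOn h.contDiff hx (y := fun t => ξ (t - t₀) (x t₀))
        (fun t _ => (hsol _ t).hasDerivWithinAt) (by simp [hξ0]) ht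
    rw [hlock, hxt]
    exact hatt _ (hW0 _ hxW) (hdev _ (hWr hxW)) _ (sub_nonneg.2 ht)
  · obtain ⟨δ, hδ, hsub'⟩ := hφ.exists_thickening_subset h h0 hw hX₀
    refine ⟨δ, hδ, fun X hX => ?_⟩
    rw [hrange] at hX
    obtain ⟨_, ⟨σ, rfl⟩, hσ⟩ := (Metric.infDist_lt_iff (Set.range_nonempty _)).1 hX
    exact hsub' X σ hσ
  · rw [hrange]
    exact hφ.isOrbitallyAsymptoticallyStable h hξ0 hξ t₀ h0 hw hX₀

end MeanField

/-! ### Periodic functions and the periodic weight. -/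

/-- Uniform continuity, near a line, of a function that is periodic in the direction of the line. -/
theorem Continuous.exists_delta_near_line {E F : Type*} [NormedAddCommGroup E] [NormedSpace ℝ E]
    [NormedAddCommGroup F] {g : E → F} (hg : Continuous g) {e : E} (he : Function.Periodic g e)
    {ε : ℝ} (hε : 0 < ε) : ∃ δ > 0, ∀ (s : ℝ) (p : E), ‖p - s • e‖ ≤ δ → ‖g p - g (s • e)‖ ≤ ε := by
  obtain ⟨δ, hδ, H⟩ := (isCompact_Icc.image (s := Set.Icc (0 : ℝ) 1)
    (show Continuous fun s : ℝ => s • e by fun_prop)).exists_delta_norm_sub_le hg hε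
  refine ⟨δ / 2, by positivity, fun s p hp => ?_⟩
  have h1 : g (p - ⌊s⌋ • e) = g p := he.sub_zsmul_eq _
  have h2 : g (s • e - ⌊s⌋ • e) = g (s • e) := he.sub_zsmul_eq _
  have h3 : s • e - ⌊s⌋ • e = Int.fract s • e := by
    rw [← Int.cast_smul_eq_zsmul ℝ, ← sub_smul, Int.self_sub_floor]
  rw [← h1, ← h2, h3]
  refine (H _ ⟨_, ⟨Int.fract_nonneg s, (Int.fract_lt_one s).le⟩, rfl⟩ _ ?_).le
  simp only [← h3, sub_sub_sub_cancel_right]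
  linarith

theorem Function.Periodic.exists_norm_le_of_continuous {F : Type*} [NormedAddCommGroup F]
    {g : ℝ → F} (he : Function.Periodic g 1) (hg : Continuous g) : ∃ C, ∀ s, ‖g s‖ ≤ C := by
  obtain ⟨C, hC⟩ := isCompact_Icc.exists_bound_of_continuousOn (s := Set.Icc (0 : ℝ) 1)
    hg.continuousOn
  refine ⟨C, fun s => ?_⟩
  obtain ⟨y, hy, hys⟩ := he.exists_mem_Ico₀ one_pos s
  rw [hys]; exact hC y ⟨hy.1, hy.2.le⟩

theorem Function.Periodic.exists_pos_le_of_continuous {g : ℝ → ℝ} (he : Function.Periodic g 1)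
    (hg : Continuous g) (hpos : ∀ s ∈ Set.Icc (0 : ℝ) 1, 0 < g s) : ∃ m > 0, ∀ s, m ≤ g s := by
  obtain ⟨p, hp, hmin⟩ := isCompact_Icc.exists_isMinOn (s := Set.Icc (0 : ℝ) 1) ⟨0, by simp⟩
    hg.continuousOn
  refine ⟨g p, hpos p hp, fun s => ?_⟩
  obtain ⟨y, hy, hys⟩ := he.exists_mem_Ico₀ one_pos s
  rw [hys]; exact hmin ⟨hy.1, hy.2.le⟩

/-- The periodic weight that turns an exponent of negative mean into a constant rate. -/
theorem exists_periodic_weight {b : ℝ → ℝ} (hb : Continuous b) (hper : Function.Periodic b 1)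
    (hneg : ∫ s in (0 : ℝ)..1, b s < 0) :
    ∃ lam > 0, ∃ w : ℝ → ℝ, (∀ s, 0 < w s) ∧ Function.Periodic w 1 ∧
      (∀ s, HasDerivAt w (w s * (b s + lam)) s) ∧ ContDiff ℝ 1 w := by
  -- With this choice `b + lam` has mean zero, so the exponential of its primitive is periodic.
  set lam := -∫ s in (0 : ℝ)..1, b s
  have hc : Continuous fun s => b s + lam := by fun_prop
  have hd : ∀ s, HasDerivAt (fun s => Real.exp (∫ u in (0 : ℝ)..s, (b u + lam)))
      (Real.exp (∫ u in (0 : ℝ)..s, (b u + lam)) * (b s + lam)) s := fun s =>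
    (intervalIntegral.integral_hasDerivAt_right (hc.intervalIntegrable _ _)
      (hc.stronglyMeasurableAtFilter _ _) hc.continuousAt).exp
  refine ⟨lam, by simpa [lam] using hneg, _, fun s => Real.exp_pos _, fun s => ?_, hd, ?_⟩
  · have hper' : Function.Periodic (fun s => b s + lam) 1 := fun s => by simp only [hper s]
    have h1 := hper'.intervalIntegral_add_eq s 0
    have h2 : ∫ u in (0 : ℝ)..(0 + 1), (b u + lam) = 0 := by
      rw [zero_add, intervalIntegral.integral_add (hb.intervalIntegrable _ _)
        (continuous_const.intervalIntegrable _ _)]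
      simp [lam]
    have h3 := intervalIntegral.integral_add_adjacent_intervals
      (hc.intervalIntegrable (μ := MeasureTheory.volume) 0 s) (hc.intervalIntegrable s (s + 1))
    simp only
    rw [← h3, h1, h2, add_zero]
  · rw [contDiff_one_iff_deriv]
    refine ⟨fun s => (hd s).differentiableAt, ?_⟩
    rw [show deriv _ = _ from funext fun s => (hd s).deriv]
    exact (continuous_iff_continuousAt.2 fun s => (hd s).continuousAt).mul hc

/-! ### Consequences of (H) near the diagonal, and the strip norms. -/

namespace MeanField

variable {N : ℕ} {F : (Fin N → ℝ) → ℝ → ℝ}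

theorem joint_snoc (F : (Fin N → ℝ) → ℝ → ℝ) (X : Fin N → ℝ) (z : ℝ) :
    joint F (Fin.snoc (α := fun _ => ℝ) X z) = F X z := by
  simp [joint]

/-- On the product space the derivative splits into a mean-field part, on `(v, 0)`, and an own-state
part, on `(0, 1)`; the rest of the argument relies on this splitting. -/
theorem HypH.contDiff_uncurry (hF : HypH F) :
    ContDiff ℝ 2 (fun p : (Fin N → ℝ) × ℝ => F p.1 p.2) := by
  have h1 : ContDiff ℝ 2 (fun p : (Fin N → ℝ) × ℝ => Fin.snoc (α := fun _ => ℝ) p.1 p.2) := by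
    refine contDiff_pi.2 fun i => ?_
    refine Fin.lastCases ?_ (fun j => ?_) i
    · simpa using contDiff_snd
    · simpa [Function.comp_def] using (contDiff_apply ℝ ℝ j).comp contDiff_fst
  have h2 := hF.contDiff.comp h1
  simpa only [Function.comp_def, joint_snoc] using h2

theorem HypH.periodic_uncurry (hF : HypH F) :
    Function.Periodic (fun p : (Fin N → ℝ) × ℝ => F p.1 p.2) (1, 1) := by
  intro p
  have h1 := hF.periodic (Fin.snoc (α := fun _ => ℝ) p.1 p.2)
  have h2 : Fin.snoc (α := fun _ => ℝ) p.1 p.2 + (1 : Fin (N + 1) → ℝ)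
      = Fin.snoc (α := fun _ => ℝ) (p.1 + 1) (p.2 + 1) := by
    ext i
    refine Fin.lastCases ?_ (fun j => ?_) i <;> simp
  rw [h2, joint_snoc, joint_snoc] at h1
  exact h1

theorem smul_one_eq_diag (s : ℝ) : s • ((1, 1) : (Fin N → ℝ) × ℝ) = (diag N s, s) := by
  ext <;> simp [diag]

/-- The derivative of `F`, as a function of `N + 1` variables, on the diagonal. -/
noncomputable def diagDeriv (F : (Fin N → ℝ) → ℝ → ℝ) (s : ℝ) : (Fin N → ℝ) × ℝ →L[ℝ] ℝ :=
  fderiv ℝ (fun p : (Fin N → ℝ) × ℝ => F p.1 p.2) (diag N s, s)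

/-- The transverse exponent per unit of the diagonal coordinate. -/
noncomputable def transverseRate (F : (Fin N → ℝ) → ℝ → ℝ) (s : ℝ) : ℝ :=
  diagDeriv F s (0, 1) / F (diag N s) s

theorem HypH.differentiable (hF : HypH F) :
    Differentiable ℝ (fun p : (Fin N → ℝ) × ℝ => F p.1 p.2) :=
  hF.contDiff_uncurry.differentiable two_ne_zero

theorem HypH.continuous_fderiv (hF : HypH F) :
    Continuous (fderiv ℝ (fun p : (Fin N → ℝ) × ℝ => F p.1 p.2)) :=
  hF.contDiff_uncurry.continuous_fderiv two_ne_zero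

theorem HypH.deriv_eq (hF : HypH F) (s : ℝ) :
    deriv (fun z => F (diag N s) z) s = diagDeriv F s (0, 1) := by
  have h1 : HasDerivAt (fun z : ℝ => (diag N s, z)) ((0 : Fin N → ℝ), (1 : ℝ)) s :=
    (hasDerivAt_const s _).prodMk (hasDerivAt_id s)
  exact ((hF.differentiable (diag N s, s)).hasFDerivAt.comp_hasDerivAt s h1).deriv

theorem periodic_fderiv {E F : Type*} [NormedAddCommGroup E] [NormedSpace ℝ E]
    [NormedAddCommGroup F] [NormedSpace ℝ F] {g : E → F} {e : E} (he : Function.Periodic g e) :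
    Function.Periodic (fderiv ℝ g) e := fun x => by
  rw [← fderiv_comp_add_right]
  congr 1
  exact funext he

theorem HypH.continuous_diagDeriv (hF : HypH F) : Continuous (diagDeriv F) := by
  have := hF.continuous_fderiv.comp
    (show Continuous fun s : ℝ => s • ((1, 1) : (Fin N → ℝ) × ℝ) by fun_prop)
  simp only [Function.comp_def, smul_one_eq_diag] at this
  exact this

theorem HypH.continuous_diag (hF : HypH F) : Continuous (fun s => F (diag N s) s) := by
  have := hF.contDiff_uncurry.continuous.comp
    (show Continuous fun s : ℝ => s • ((1, 1) : (Fin N → ℝ) × ℝ) by fun_prop)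
  simpa only [Function.comp_def, smul_one_eq_diag] using this

theorem HypH.periodic_diag (hF : HypH F) : Function.Periodic (fun s => F (diag N s) s) 1 :=
  fun s => hF.periodic_uncurry (diag N s, s)

theorem HypH.periodic_diagDeriv (hF : HypH F) : Function.Periodic (diagDeriv F) 1 :=
  fun s => periodic_fderiv hF.periodic_uncurry (diag N s, s)

/-- Uniform differentiability of `F` near the diagonal. -/
theorem HypH.exists_estimates (hF : HypH F) :
    ∃ m > 0, ∃ M, (∀ s, m ≤ F (diag N s) s) ∧ (∀ s, |F (diag N s) s| ≤ M) ∧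
      (∀ s, ‖diagDeriv F s‖ ≤ M) ∧ Continuous (transverseRate F) ∧
      Function.Periodic (transverseRate F) 1 ∧
      ∀ ε > 0, ∃ η > 0, ∀ (s : ℝ) (p q : (Fin N → ℝ) × ℝ), ‖p - (diag N s, s)‖ ≤ η →
        ‖q - (diag N s, s)‖ ≤ η → |F p.1 p.2 - F (diag N s) s| ≤ ε ∧
          |F p.1 p.2 - F q.1 q.2 - diagDeriv F s (p - q)| ≤ ε * ‖p - q‖ := by
  obtain ⟨m, hm, hmle⟩ := hF.periodic_diag.exists_pos_le_of_continuous hF.continuous_diag hF.pos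
  obtain ⟨M₁, hM₁⟩ := hF.periodic_diag.exists_norm_le_of_continuous hF.continuous_diag
  obtain ⟨M₂, hM₂⟩ := hF.periodic_diagDeriv.exists_norm_le_of_continuous hF.continuous_diagDeriv
  refine ⟨m, hm, max M₁ M₂, hmle, fun s => (hM₁ s).trans (le_max_left _ _),
    fun s => (hM₂ s).trans (le_max_right _ _), ?_, fun s => ?_, fun ε hε => ?_⟩
  · exact (hF.continuous_diagDeriv.clm_apply continuous_const).div hF.continuous_diag
      fun s => (hm.trans_le (hmle s)).ne'
  · have h1 := hF.periodic_diag s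
    simp only at h1
    rw [transverseRate, transverseRate, hF.periodic_diagDeriv s, h1]
  · obtain ⟨η₁, hη₁, h1⟩ := hF.contDiff_uncurry.continuous.exists_delta_near_line
      hF.periodic_uncurry hε
    obtain ⟨η₂, hη₂, h2⟩ := hF.continuous_fderiv.exists_delta_near_line
      (periodic_fderiv hF.periodic_uncurry) hε
    refine ⟨min η₁ η₂, by positivity, fun s p q hp hq => ⟨?_, ?_⟩⟩
    · have := h1 s p (by rw [smul_one_eq_diag]; exact hp.trans (min_le_left _ _))
      rwa [smul_one_eq_diag] at this
    · have := (convex_closedBall (diag N s, s) η₂).norm_image_sub_le_of_norm_fderiv_le' (𝕜 := ℝ)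
        (f := fun p : (Fin N → ℝ) × ℝ => F p.1 p.2) (φ := diagDeriv F s) (C := ε) (x := q) (y := p)
        (fun p _ => hF.differentiable p) (fun p hp => by
          have := h2 s p (by rwa [smul_one_eq_diag, ← mem_closedBall_iff_norm])
          rwa [smul_one_eq_diag] at this)
        (mem_closedBall_iff_norm.2 (hq.trans (min_le_right _ _)))
        (mem_closedBall_iff_norm.2 (hp.trans (min_le_right _ _)))
      exact this

theorem norm_le_of_stripNorm_lt {q : ℕ} {g : (Fin q → ℝ) → ℝ} {r : ℝ}
    (h : stripNorm g < ENNReal.ofReal r) {y : Fin q → ℝ} (hy : y ∈ strip q) : |g y| < r := by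
  have h1 : ‖g y‖ₑ ≤ stripNorm g := le_iSup₂ (f := fun y (_ : y ∈ strip q) => ‖g y‖ₑ) y hy
  have h2 := h1.trans_lt h
  rw [← ofReal_norm, ENNReal.ofReal_lt_ofReal_iff_of_nonneg (norm_nonneg _)] at h2
  exact h2

theorem norm_le_of_stripNormVec_lt {q p : ℕ} {g : (Fin q → ℝ) → (Fin p → ℝ)} {r : ℝ}
    (h : stripNormVec g < ENNReal.ofReal r) {y : Fin q → ℝ} (hy : y ∈ strip q) (i : Fin p) :
    |g y i| < r :=
  norm_le_of_stripNorm_lt (g := fun y => g y i)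
    ((le_iSup (fun i => stripNorm (fun y => g y i)) i).trans_lt h) hy

theorem norm_fderiv_le_of_stripNormDVec_lt {q p : ℕ} {g : (Fin q → ℝ) → (Fin p → ℝ)} {r : ℝ}
    (h : stripNormDVec g < ENNReal.ofReal r) {y : Fin q → ℝ} (hy : y ∈ strip q) (i : Fin p) :
    ‖fderiv ℝ (fun y => g y i) y‖ ≤ q * r := by
  have h1 : ∀ j, |fderiv ℝ (fun y => g y i) y (Pi.single j 1)| < r := fun j =>
    norm_le_of_stripNorm_lt (g := partialD j (fun y => g y i))
      (((le_iSup (fun j => stripNorm (partialD j fun y => g y i)) j).trans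
        (le_iSup (fun i => stripNormD (fun y => g y i)) i)).trans_lt h) hy
  have hr : 0 ≤ r := by
    by_contra! hneg
    rw [ENNReal.ofReal_of_nonpos hneg.le] at h
    exact not_lt_bot h
  refine ContinuousLinearMap.opNorm_le_bound _ (by positivity) fun v => ?_
  have h2 : v = ∑ j, v j • (Pi.single j 1 : Fin q → ℝ) := by
    ext k
    simp [Finset.sum_apply, Pi.single_apply]
  calc ‖fderiv ℝ (fun y => g y i) y v‖
      = ‖∑ j, v j • fderiv ℝ (fun y => g y i) y (Pi.single j 1)‖ := by
        conv_lhs => rw [h2]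
        rw [map_sum]; simp only [map_smul]
    _ ≤ ∑ j : Fin q, ‖v‖ * r := by
        refine norm_sum_le_of_le _ fun j _ => ?_
        rw [norm_smul]
        exact mul_le_mul (norm_le_pi_norm v j) (h1 j).le (norm_nonneg _) (norm_nonneg _)
    _ = q * r * ‖v‖ := by simp; ring

theorem closedBall_diag_subset_strip {s η : ℝ} (hη : η ≤ 1 / 2) :
    Metric.closedBall (diag N s) η ⊆ strip N := by
  intro X hX i j
  have h1 : ∀ i, |X i - s| ≤ 1 / 2 := fun i =>
    (norm_le_pi_norm (X - diag N s) i).trans ((mem_closedBall_iff_norm.1 hX).trans hη)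
  have h2 := abs_sub_le (X i) s (X j)
  rw [abs_sub_comm s] at h2
  linarith [h1 i, h1 j]

end MeanField

/-! ### The synchronization region. -/

namespace MeanField

variable {N : ℕ} {F : (Fin N → ℝ) → ℝ → ℝ} {H : (Fin N → ℝ) → (Fin N → ℝ)}

theorem contDiff_field (hF : ContDiff ℝ 1 (fun p : (Fin N → ℝ) × ℝ => F p.1 p.2))
    (hH : ContDiff ℝ 1 H) : ContDiff ℝ 1 (field F H) := by
  refine contDiff_pi.2 fun i => ?_
  exact (hF.comp (contDiff_id.prodMk (contDiff_apply ℝ ℝ i))).add (contDiff_pi.1 hH i)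

/-- Solutions starting in the tube stay in the tube: the tube is carried along by a test particle
`ν` in the mean field. -/
theorem exists_solution_in_tube [Nonempty (Fin N)]
    (hF : ContDiff ℝ 1 (fun p : (Fin N → ℝ) × ℝ => F p.1 p.2)) (hH : ContDiff ℝ 1 H)
    {b Δ : ℝ → ℝ} {lam η m M r : ℝ} (hlam : 0 < lam) (hη : 0 < η) (hm : 0 < m)
    (hΔ0 : ∀ s, 0 < Δ s) (hΔη : ∀ s, Δ s ≤ η / 2)
    (hΔ : ∀ s, HasDerivAt Δ (Δ s * (b s + lam)) s)
    (hFM : ∀ s X, ‖X - diag N s‖ ≤ η → |F X s| ≤ M ∧ ∀ i, |F X (X i)| ≤ M)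
    (hFm : ∀ s X, ‖X - diag N s‖ ≤ η → m / 2 ≤ F X s)
    (hHr : ∀ s X, ‖X - diag N s‖ ≤ η → ∀ i, |H X i| ≤ r)
    (hest : ∀ s X, ‖X - diag N s‖ ≤ η → ∀ i,
      |F X (X i) - F X s - b s * F X s * (X i - s)| ≤ lam * m / 8 * ‖X - diag N s‖)
    (hr : ∀ s, r ≤ lam * m * Δ s / 8) (t₀ : ℝ) {X : Fin N → ℝ} {ν₀ : ℝ}
    (hX : ‖X - diag N ν₀‖ < Δ ν₀) :
    ∃ (x : ℝ → Fin N → ℝ) (ν : ℝ → ℝ), x t₀ = X ∧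
      ∀ t, t₀ ≤ t → HasDerivAt x (field F H (x t)) t ∧ ‖x t - diag N (ν t)‖ < Δ (ν t) := by
  -- The cutoff bounds the coupled field of `X` and the test particle, so solutions are global. It
  -- equals one wherever the tube argument takes place, hence is harmless afterwards.
  let χ : ContDiffBump (0 : Fin N → ℝ) := ⟨η / 2, η, by positivity, by linarith⟩
  set u : (Fin N → ℝ) × ℝ → Fin N → ℝ := fun p => p.1 - diag N p.2
  have hu : ContDiff ℝ 1 u := contDiff_fst.sub (contDiff_pi.2 fun _ => contDiff_snd)
  set 𝒱 : (Fin N → ℝ) × ℝ → (Fin N → ℝ) × ℝ := fun p => χ (u p) • (field F H p.1, F p.1 p.2)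
  have h𝒱 : ContDiff ℝ 1 𝒱 := (χ.contDiff.comp hu).smul
    (((contDiff_field hF hH).comp contDiff_fst).prodMk hF)
  have hbound : ∀ p, ‖𝒱 p‖ ≤ M + r := by
    intro p
    have hM0 : 0 ≤ M := (abs_nonneg _).trans (hFM 0 (diag N 0) (by simp [hη.le])).1
    obtain ⟨i₀⟩ := ‹Nonempty (Fin N)›
    have hr0 : 0 ≤ r := (abs_nonneg _).trans (hHr 0 (diag N 0) (by simp [hη.le]) i₀)
    by_cases hp : ‖u p‖ ≤ η
    · have h1 : ‖(field F H p.1, F p.1 p.2)‖ ≤ M + r := by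
        refine max_le ((pi_norm_le_iff_of_nonneg (by positivity)).2 fun i => ?_) ?_
        · exact (norm_add_le _ _).trans (add_le_add ((hFM p.2 p.1 hp).2 i) (hHr p.2 p.1 hp i))
        · exact (hFM p.2 p.1 hp).1.trans (by linarith)
      rw [norm_smul, Real.norm_of_nonneg χ.nonneg]
      calc _ ≤ 1 * (M + r) := mul_le_mul χ.le_one h1 (norm_nonneg _) zero_le_one
        _ = _ := one_mul _
    · have h1 : χ (u p) = 0 := χ.zero_of_le_dist (by
        rw [dist_zero_right]; exact (not_le.1 hp).le)
      simp only [𝒱, h1, zero_smul, norm_zero]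
      positivity
  obtain ⟨γ, hγ0, hγ⟩ := exists_isIntegralCurve_of_contDiff_of_bounded h𝒱 hbound (X, ν₀)
  set ν : ℝ → ℝ := fun t => (γ t).2
  have hχ1 : ∀ t, ‖u (γ t)‖ ≤ η / 2 → χ (u (γ t)) = 1 := fun t ht =>
    χ.one_of_mem_closedBall (mem_closedBall_zero_iff.2 ht)
  have hx' : ∀ t, HasDerivAt (fun t => (γ t).1) (χ (u (γ t)) • field F H (γ t).1) t := fun t =>
    (ContinuousLinearMap.fst ℝ (Fin N → ℝ) ℝ).hasFDerivAt.comp_hasDerivAt t (hγ t)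
  have hν' : ∀ t, HasDerivAt ν (χ (u (γ t)) * F (γ t).1 (ν t)) t := fun t =>
    (ContinuousLinearMap.snd ℝ (Fin N → ℝ) ℝ).hasFDerivAt.comp_hasDerivAt t (hγ t)
  have hu' : ∀ t, HasDerivAt (fun t => u (γ t))
      (χ (u (γ t)) • (field F H (γ t).1 - F (γ t).1 (ν t) • 1)) t := fun t => by
    have h1 := (hx' t).sub ((hasDerivAt_diag N (ν t)).scomp t (hν' t))
    refine h1.congr_deriv ?_
    rw [smul_sub, smul_smul]
  set μ : ℝ → ℝ := fun s => Real.exp (lam * s) / Δ s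
  have hμ0 : ∀ s, 0 < μ s := fun s => div_pos (Real.exp_pos _) (hΔ0 s)
  have hμ' : ∀ s, HasDerivAt μ (-(b s * μ s)) s := fun s => by
    have h1 : HasDerivAt (fun s => Real.exp (lam * s)) (Real.exp (lam * s) * lam) s := by
      simpa using ((hasDerivAt_id s).const_mul lam).exp
    refine (h1.div (hΔ s) (hΔ0 s).ne').congr_deriv ?_
    have := (hΔ0 s).ne'
    simp only [μ]
    field_simp
    ring
  -- `θ < 1` keeps the orbit in the open tube. `θ ≥ 1/2` places the barrier far enough out for the
  -- bound on `H`, which is proportional to `Δ`, to be dominated there.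
  obtain ⟨θ, hθ, hθ1, hXθ⟩ : ∃ θ, 1 / 2 ≤ θ ∧ θ < 1 ∧ ‖X - diag N ν₀‖ ≤ θ * Δ ν₀ :=
    ⟨max (1 / 2) (‖X - diag N ν₀‖ / Δ ν₀), le_max_left _ _,
      max_lt (by norm_num) ((div_lt_one (hΔ0 _)).2 hX), by
        rw [← div_le_iff₀ (hΔ0 _)]; exact le_max_right _ _⟩
  have hf : ∀ t, HasDerivAt (fun t => μ (ν t) • u (γ t))
      (μ (ν t) • (χ (u (γ t)) • (field F H (γ t).1 - F (γ t).1 (ν t) • 1)) +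
        (-(b (ν t) * μ (ν t)) * (χ (u (γ t)) * F (γ t).1 (ν t))) • u (γ t)) t := fun t =>
    ((hμ' (ν t)).comp t (hν' t)).smul (hu' t)
  have hB : ∀ t, HasDerivAt (fun t => θ * Real.exp (lam * ν t))
      (θ * (Real.exp (lam * ν t) * (lam * (χ (u (γ t)) * F (γ t).1 (ν t))))) t := fun t =>
    (((hν' t).const_mul lam).exp).const_mul θ
  have key : ∀ t, 0 ≤ t → ‖u (γ t)‖ ≤ θ * Δ (ν t) := by
    intro T hT
    have := image_norm_le_of_norm_deriv_right_lt_deriv_boundary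
      (f := fun t => μ (ν t) • u (γ t)) (a := 0) (b := T)
      (fun t _ => (hf t).continuousAt.continuousWithinAt) (fun t _ => (hf t).hasDerivWithinAt)
      (B := fun t => θ * Real.exp (lam * ν t)) (by
        have h1 : ν 0 = ν₀ := by simp [ν, hγ0]
        have h2 : u (γ 0) = X - diag N ν₀ := by simp [u, hγ0]
        rw [norm_smul, h1, h2, Real.norm_of_nonneg (hμ0 _).le]
        calc μ ν₀ * ‖X - diag N ν₀‖ ≤ μ ν₀ * (θ * Δ ν₀) := by
              have := hμ0 ν₀
              gcongr
          _ = _ := by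
              have := (hΔ0 ν₀).ne'
              simp only [μ]; field_simp) hB
      (fun t _ hn => by
        set s := ν t
        set Y := (γ t).1
        have hd : ‖u (γ t)‖ = θ * Δ s := by
          rw [norm_smul, Real.norm_of_nonneg (hμ0 _).le] at hn
          have h3 := (Real.exp_pos (lam * s)).ne'
          have h4 := (hΔ0 s).ne'
          simp only [μ] at hn
          field_simp at hn
          linarith
        have hΔs := hΔ0 s
        have hdη : ‖u (γ t)‖ ≤ η / 2 := by
          rw [hd]; nlinarith [hΔη s]
        have hYη : ‖Y - diag N s‖ ≤ η := hdη.trans (by linarith)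
        have h1 := hχ1 t hdη
        have hFs := hFm s Y hYη
        rw [h1, one_smul, one_mul]
        have hpos : 0 < θ * (Real.exp (lam * s) * (lam * F Y s)) := by
          have : 0 < F Y s := by linarith
          have : 0 < θ := by linarith
          have := Real.exp_pos (lam * s)
          positivity
        rw [pi_norm_lt_iff hpos]
        intro i
        have h5 : (μ s • (field F H Y - F Y s • 1) + (-(b s * μ s) * F Y s) • u (γ t)) i
            = μ s * (F Y (Y i) - F Y s - b s * F Y s * (Y i - s) + H Y i) := by
          simp [u, field, diag_apply, Y, s, ν]; ring
        rw [h5, norm_mul, Real.norm_of_nonneg (hμ0 s).le, Real.norm_eq_abs]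
        have h6 := hest s Y hYη i
        have h7 := hHr s Y hYη i
        have h8 : ‖Y - diag N s‖ = θ * Δ s := hd
        rw [h8] at h6
        have h9 := hr s
        -- In units of `lam * m * θ * Δ` the errors are at most `1/8` from `F` and `1/4` from `H`;
        -- the margin is at least `1/2`.
        have h10 : |F Y (Y i) - F Y s - b s * F Y s * (Y i - s) + H Y i| <
            lam * F Y s * (θ * Δ s) := by
          refine (abs_add_le _ _).trans_lt ?_
          have h11 : lam * m * (θ * Δ s) / 2 ≤ lam * F Y s * (θ * Δ s) := by
            have h12 : 0 ≤ lam * (θ * Δ s) := by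
              have : 0 < θ := by linarith
              positivity
            nlinarith
          have h13 : lam * m * Δ s * (1 / 2) ≤ lam * m * Δ s * θ := by gcongr
          have h14 : 0 < lam * m * Δ s := by positivity
          nlinarith
        calc _ < μ s * (lam * F Y s * (θ * Δ s)) := mul_lt_mul_of_pos_left h10 (hμ0 s)
          _ = _ := by
            have := hΔs.ne'
            simp only [μ]; field_simp)
      (Set.right_mem_Icc.2 hT)
    have h1 := hΔ0 (ν T)
    have h2 := Real.exp_pos (lam * ν T)
    rw [norm_smul, Real.norm_of_nonneg (hμ0 _).le] at this
    simp only [μ] at this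
    rw [div_mul_eq_mul_div, div_le_iff₀ h1] at this
    nlinarith
  refine ⟨fun t => (γ (t - t₀)).1, fun t => ν (t - t₀), by simp [hγ0], fun t ht => ?_⟩
  have hk := key (t - t₀) (sub_nonneg.2 ht)
  have h1 := hΔ0 (ν (t - t₀))
  constructor
  · have h2 := (hx' (t - t₀)).comp_sub_const t t₀
    rwa [hχ1 _ (hk.trans (by nlinarith [hΔη (ν (t - t₀))])), one_smul] at h2
  · exact hk.trans_lt (by nlinarith)

theorem mem_tube_iff {Δ : ℝ → ℝ} (hΔ : ∀ s, 0 < Δ s) {X : Fin N → ℝ} :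
    X ∈ tube N Δ ↔ ∃ ν, ‖X - diag N ν‖ < Δ ν := by
  simp only [tube, Set.mem_ofPred_eq]
  exact exists_congr fun ν => (pi_norm_lt_iff (x := X - diag N ν) (hΔ ν)).symm

theorem isOpen_tube {Δ : ℝ → ℝ} (hΔ : ∀ s, 0 < Δ s) : IsOpen (tube N Δ) := by
  have h1 : tube N Δ = ⋃ ν, {X | ‖X - diag N ν‖ < Δ ν} := by
    ext X; rw [mem_tube_iff hΔ, Set.mem_iUnion]; rfl
  rw [h1]
  exact isOpen_iUnion fun ν => isOpen_lt (by fun_prop) continuous_const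

/-- The tube is a synchronization region. -/
theorem isSyncRegion_tube [Nonempty (Fin N)]
    (hF : ContDiff ℝ 1 (fun p : (Fin N → ℝ) × ℝ => F p.1 p.2))
    {b Δ : ℝ → ℝ} {lam η m M r D : ℝ} (hlam : 0 < lam) (hη : 0 < η) (hη1 : η ≤ 1 / 2)
    (hm : 0 < m) (hΔ0 : ∀ s, 0 < Δ s) (hΔD : ∀ s, Δ s ≤ D) (hDη : D ≤ η / 2)
    (hΔc : ContDiff ℝ 1 Δ) (hΔp : Function.Periodic Δ 1)
    (hΔ : ∀ s, HasDerivAt Δ (Δ s * (b s + lam)) s)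
    (hFM : ∀ s X, ‖X - diag N s‖ ≤ η → |F X s| ≤ M ∧ ∀ i, |F X (X i)| ≤ M)
    (hFm : ∀ s X, ‖X - diag N s‖ ≤ η → m / 2 ≤ F X s ∧ ∀ i, m / 2 ≤ F X (X i))
    (hest : ∀ s X, ‖X - diag N s‖ ≤ η → ∀ i,
      |F X (X i) - F X s - b s * F X s * (X i - s)| ≤ lam * m / 8 * ‖X - diag N s‖)
    (hr : ∀ s, r ≤ lam * m * Δ s / 8) (hrm : r ≤ m / 4) (t₀ : ℝ) :
    IsSyncRegion F t₀ D r (tube N Δ) := by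
  have hHr : ∀ H : (Fin N → ℝ) → (Fin N → ℝ), stripNormVec H < ENNReal.ofReal r →
      ∀ s X, ‖X - diag N s‖ ≤ η → ∀ i, |H X i| ≤ r := fun H hH s X hX i =>
    (norm_le_of_stripNormVec_lt hH
      (closedBall_diag_subset_strip hη1 (mem_closedBall_iff_norm.2 hX)) i).le
  have hex : ∀ H : (Fin N → ℝ) → (Fin N → ℝ), ContDiff ℝ 1 H →
      stripNormVec H < ENNReal.ofReal r → ∀ X ∈ tube N Δ,
      ∃ (x : ℝ → Fin N → ℝ) (ν : ℝ → ℝ), x t₀ = X ∧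
      ∀ t, t₀ ≤ t → HasDerivAt x (field F H (x t)) t ∧ ‖x t - diag N (ν t)‖ < Δ (ν t) := by
    intro H hHc hH X hX
    obtain ⟨ν₀, hν₀⟩ := (mem_tube_iff hΔ0).1 hX
    exact exists_solution_in_tube hF hHc hlam hη hm hΔ0 (fun s => (hΔD s).trans hDη) hΔ hFM
      (fun s X hX => (hFm s X hX).1) (hHr H hH) hest hr t₀ hν₀
  refine ⟨isOpen_tube hΔ0, ⟨Δ, hΔc, hΔp, fun s => ⟨hΔ0 s, hΔD s⟩, rfl⟩, ?_, ?_⟩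
  · intro H hHc hH X hX
    obtain ⟨x, ν, hx0, hx⟩ := hex H hHc hH X hX
    exact ⟨x, hx0, fun t ht => (hx t ht).1.hasDerivWithinAt⟩
  · intro H hHc hH y hy hyC
    obtain ⟨x, ν, hx0, hx⟩ := hex H hHc hH _ hyC
    have hyx : ∀ t, t₀ ≤ t → y t = x t := fun t ht =>
      eqOn_Ici_of_isIntegralCurveOn (contDiff_field hF hHc) hy
        (fun t ht => (hx t ht).1.hasDerivWithinAt) hx0.symm ht
    have hyν : ∀ t, t₀ ≤ t → ‖y t - diag N (ν t)‖ < Δ (ν t) := fun t ht => by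
      rw [hyx t ht]; exact (hx t ht).2
    refine ⟨fun t ht => (mem_tube_iff hΔ0).2 ⟨ν t, hyν t ht⟩, ⟨m / 4, by positivity,
      fun t ht i => ?_⟩, fun t ht i j => ?_⟩
    · have h1 : ‖y t - diag N (ν t)‖ ≤ η := by linarith [hyν t ht, hΔD (ν t)]
      have h2 := (hFm _ _ h1).2 i
      have h3 := (abs_le.1 (hHr H hH _ _ h1 i)).1
      simp only [field]
      linarith
    · have h1 := hyν t ht
      have h2 : ∀ i, |y t i - ν t| < D := fun i =>
        (norm_le_pi_norm (y t - diag N (ν t)) i).trans_lt (h1.trans_le (hΔD _))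
      have h3 := abs_sub_le (y t i) (ν t) (y t j)
      rw [abs_sub_comm (ν t)] at h3
      linarith [h2 i, h2 j]

end MeanField

/-! ### Contraction by the perturbed field, and the cutoff. -/

namespace MeanField

variable {N : ℕ} {F : (Fin N → ℝ) → ℝ → ℝ} {H : (Fin N → ℝ) → (Fin N → ℝ)}

/-- Perturbation of a difference of quotients. -/
theorem abs_div_sub_div_sub_le {f m M e d P a δ v v' u u' : ℝ} (hm : 0 < m) (hM : 0 ≤ M)
    (hd : 0 ≤ d) (hfm : m ≤ f) (hem : e ≤ m / 2) (hP : |P| ≤ M * d)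
    (hδ : |δ| ≤ d) (ha : |a| ≤ M) (hv : |v - v' - (P + a * δ)| ≤ e * d)
    (hu : |u - u' - P| ≤ e * d) (hv' : |v' - f| ≤ e) (hu' : |u' - f| ≤ e) (hu₀ : |u - f| ≤ e) :
    |v / u - v' / u' - a / f * δ| ≤ (4 / m + 8 * (M + m) / m ^ 2 + 2 * M / m ^ 2) * e * d := by
  have he : 0 ≤ e := (abs_nonneg _).trans hu'
  have hum : m / 2 ≤ u := by linarith [(abs_le.1 hu₀).1]
  have hum' : m / 2 ≤ u' := by linarith [(abs_le.1 hu').1]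
  have hu0 : 0 < u := by linarith
  have hu0' : 0 < u' := by linarith
  have hf0 : 0 < f := by linarith
  -- The common increment `P` cancels in the first numerator. The second term is small because `v'`
  -- and `u'` are both close to `f`, the third because `u` is.
  have h1 : v / u - v' / u' - a / f * δ =
      ((v - v' - (P + a * δ)) - (u - u' - P)) / u - (v' - u') * (u - u') / (u' * u) +
        a * δ * (f - u) / (u * f) := by
    field_simp
    ring
  have h2 : |((v - v' - (P + a * δ)) - (u - u' - P)) / u| ≤ 4 / m * e * d := by
    rw [abs_div, abs_of_pos hu0, div_le_iff₀ hu0]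
    calc _ ≤ e * d + e * d := (abs_sub _ _).trans (add_le_add hv hu)
      _ = 4 / m * e * d * (m / 2) := by field_simp; ring
      _ ≤ _ := by gcongr
  have h3 : |(v' - u') * (u - u') / (u' * u)| ≤ 8 * (M + m) / m ^ 2 * e * d := by
    have h4 : |v' - u'| ≤ 2 * e := by
      have := abs_sub_le v' f u'
      rw [abs_sub_comm f] at this
      linarith
    have h5 : |u - u'| ≤ (M + m) * d := by
      have := abs_add_le (u - u' - P) P
      rw [sub_add_cancel] at this
      nlinarith
    rw [abs_div, abs_mul, abs_of_pos (mul_pos hu0' hu0), div_le_iff₀ (mul_pos hu0' hu0)]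
    calc _ ≤ 2 * e * ((M + m) * d) := by gcongr
      _ = 8 * (M + m) / m ^ 2 * e * d * (m / 2 * (m / 2)) := by field_simp; ring
      _ ≤ _ := by gcongr
  have h6 : |a * δ * (f - u) / (u * f)| ≤ 2 * M / m ^ 2 * e * d := by
    rw [abs_div, abs_mul, abs_mul, abs_of_pos (mul_pos hu0 hf0), div_le_iff₀ (mul_pos hu0 hf0),
      abs_sub_comm f]
    calc _ ≤ M * d * e := by gcongr
      _ = 2 * M / m ^ 2 * e * d * (m / 2 * m) := by field_simp
      _ ≤ _ := by gcongr
  rw [h1]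
  have h7 := abs_add_le (((v - v' - (P + a * δ)) - (u - u' - P)) / u -
    (v' - u') * (u - u') / (u' * u)) (a * δ * (f - u) / (u * f))
  have h8 := abs_sub (((v - v' - (P + a * δ)) - (u - u' - P)) / u)
    ((v' - u') * (u - u') / (u' * u))
  have h9 : (4 / m + 8 * (M + m) / m ^ 2 + 2 * M / m ^ 2) * e * d =
    4 / m * e * d + 8 * (M + m) / m ^ 2 * e * d + 2 * M / m ^ 2 * e * d := by ring
  linarith

/-- A continuous periodic function that vanishes away from the diagonal is bounded. -/
theorem exists_norm_le_of_periodic_of_tube {G : Type*} [NormedAddCommGroup G] {o : Fin N}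
    {g : (Fin N → ℝ) → G} (hg : Continuous g) (hper : Function.Periodic g 1) {η : ℝ} {C : ℝ}
    (h0 : ∀ X, η < ‖X - diag N (X o)‖ → ‖g X‖ ≤ C) : ∃ C', ∀ X, ‖g X‖ ≤ C' := by
  have hK : IsCompact (Metric.closedBall (0 : Fin N → ℝ) (η + 1)) := isCompact_closedBall _ _
  obtain ⟨C₁, hC₁⟩ := hK.exists_bound_of_continuousOn hg.continuousOn
  refine ⟨max C C₁, fun X => ?_⟩
  by_cases hX : η < ‖X - diag N (X o)‖
  · exact (h0 X hX).trans (le_max_left _ _)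
  · have h1 : g (X - ⌊X o⌋ • 1) = g X := hper.sub_zsmul_eq _
    rw [← h1]
    refine (hC₁ _ (mem_closedBall_zero_iff.2 ?_)).trans (le_max_right _ _)
    have h2 : X - ⌊X o⌋ • (1 : Fin N → ℝ) = (X - diag N (X o)) + diag N (Int.fract (X o)) := by
      ext i
      simp only [Pi.sub_apply, Pi.add_apply, Pi.intCast_apply, zsmul_one, diag_apply, Int.fract]
      ring
    rw [h2]
    refine (norm_add_le _ _).trans (add_le_add (not_lt.1 hX) ?_)
    refine (pi_norm_le_iff_of_nonneg zero_le_one).2 fun i => ?_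
    rw [diag_apply, Real.norm_of_nonneg (Int.fract_nonneg _)]
    exact (Int.fract_lt_one _).le

theorem HypH.periodic_field (hF : HypH F) (hH : Function.Periodic H 1) :
    Function.Periodic (field F H) 1 := fun X => by
  ext i
  have h1 := hF.periodic_uncurry (X, X i)
  have h2 := congrFun (hH X) i
  simp only [Prod.mk_add_mk] at h1
  simp only [field, Pi.add_apply, Pi.one_apply, h2, h1]

/-- The field, cut off away from the diagonal, is contracting. -/
theorem exists_contractingField (hF : HypH F) (hH : ContDiff ℝ 1 H)
    (hHp : Function.Periodic H 1) (o : Fin N) {b Δ : ℝ → ℝ} {lam η m r : ℝ} (hlam : 0 < lam)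
    (hη : 0 < η) (hm : 0 < m) (hΔ0 : ∀ s, 0 < Δ s) (hΔη : ∀ s, Δ s ≤ η / 2)
    (hΔp : Function.Periodic Δ 1) (hΔ : ∀ s, HasDerivAt Δ (Δ s * (b s + lam)) s)
    (hVm : ∀ s X, ‖X - diag N s‖ ≤ η → m / 2 ≤ field F H X o)
    (hHr : ∀ s i, |H (diag N s) i| ≤ r) (hr : ∀ s, r ≤ lam * m * Δ s / 32)
    (hcon : ∀ X X' : Fin N → ℝ, X o = X' o → ‖X - diag N (X o)‖ ≤ η →
      ‖X' - diag N (X' o)‖ ≤ η → ∀ i,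
      |field F H X i / field F H X o - field F H X' i / field F H X' o -
        b (X o) * (X i - X' i)| ≤ lam / 2 * ‖X - X'‖) :
    ∃ V M L, ContractingField V o Δ b lam (m / 2) M L ∧
      ∀ X, ‖X - diag N (X o)‖ ≤ η / 2 → V X = field F H X := by
  let χ : ContDiffBump (0 : Fin N → ℝ) := ⟨η / 2, η, by positivity, by linarith⟩
  set u : (Fin N → ℝ) → Fin N → ℝ := fun X => X - diag N (X o)
  have hu : ContDiff ℝ 1 u := contDiff_id.sub (contDiff_pi.2 fun _ => contDiff_apply ℝ ℝ o)
  have hup : ∀ X, u (X + 1) = u X := fun X => by ext i; simp [u, diag_apply]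
  -- Blending with a constant positive field keeps the component `o` positive; being periodic and
  -- constant off the tube, `V` and its derivative are bounded.
  set V : (Fin N → ℝ) → Fin N → ℝ := fun X => χ (u X) • field F H X + (1 - χ (u X)) • diag N m
  have hχV : ContDiff ℝ 1 (fun X => χ (u X)) := χ.contDiff.comp hu
  have hVc : ContDiff ℝ 1 V :=
    (hχV.smul (contDiff_field (hF.contDiff_uncurry.of_le (by norm_num)) hH)).add
      ((contDiff_const.sub hχV).smul contDiff_const)
  have hVp : Function.Periodic V 1 := fun X => by
    simp only [V, hup, hF.periodic_field hHp X]
  have hVeq : ∀ X, ‖u X‖ ≤ η / 2 → V X = field F H X := fun X hX => by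
    have h1 : χ (u X) = 1 := χ.one_of_mem_closedBall (mem_closedBall_zero_iff.2 hX)
    simp [V, h1]
  have hVout : ∀ X, η < ‖u X‖ → V X = diag N m := fun X hX => by
    have h1 : χ (u X) = 0 := χ.zero_of_le_dist (by rw [dist_zero_right]; exact hX.le)
    simp [V, h1]
  obtain ⟨M, hM⟩ := exists_norm_le_of_periodic_of_tube hVc.continuous hVp (o := o) (η := η)
    (C := ‖diag N m‖) fun X hX => (congrArg norm (hVout X hX)).le
  obtain ⟨L, hL⟩ := exists_norm_le_of_periodic_of_tube (hVc.continuous_fderiv one_ne_zero)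
    (periodic_fderiv hVp) (o := o) (η := η) (C := 0) fun X hX => by
      have h1 : V =ᶠ[𝓝 X] fun _ => diag N m :=
        (hu.continuous.norm.continuousAt.eventually (lt_mem_nhds hX)).mono fun Y hY => hVout Y hY
      rw [h1.fderiv_eq, fderiv_const_apply, norm_zero]
  have hΔη' : ∀ X, ‖u X‖ ≤ Δ (X o) → ‖u X‖ ≤ η / 2 := fun X hX => hX.trans (hΔη _)
  refine ⟨V, M, L, ⟨hVc, hVp, hM, hL, by positivity, fun X => ?_, hlam, hΔ0, hΔp, hΔ,
    fun X hX1 hX2 i => ?_, fun X X' hXX' hX hX' i => ?_⟩, hVeq⟩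
  · have h0 : 0 ≤ χ (u X) := χ.nonneg
    have h1 : χ (u X) ≤ 1 := χ.le_one
    have h2 : V X o = χ (u X) * field F H X o + (1 - χ (u X)) * m := by simp [V, diag_apply]
    rw [h2]
    by_cases hX : ‖u X‖ ≤ η
    · have := hVm _ _ hX
      nlinarith
    · have h3 : χ (u X) = 0 :=
        χ.zero_of_le_dist (by rw [dist_zero_right]; exact (not_le.1 hX).le)
      rw [h3]; linarith
  · set s := X o
    rw [hVeq X (hΔη' X hX2)]
    have hXη : ‖X - diag N s‖ ≤ η := (hΔη' X hX2).trans (by linarith)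
    have h1 := hcon X (diag N s) rfl hXη (by simp [diag_apply, hη.le]) i
    have h2 := hVm s (diag N s) (by simp [hη.le])
    -- On the diagonal only `H` separates the components: the error is at most `2r / (m / 2)`. For
    -- distances at least `Δ / 2` it is at most a quarter of `lam` times the distance, and `hcon`
    -- costs one half.
    have h3 : |field F H (diag N s) i / field F H (diag N s) o - 1| ≤ lam * Δ s / 8 := by
      have hpos : 0 < field F H (diag N s) o := by linarith
      rw [div_sub_one hpos.ne', abs_div, abs_of_pos hpos, div_le_iff₀ hpos]
      have h4 : field F H (diag N s) i - field F H (diag N s) o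
          = H (diag N s) i - H (diag N s) o := by simp [field, diag_apply]
      rw [h4]
      have h5 := (abs_sub (H (diag N s) i) (H (diag N s) o)).trans
        (add_le_add (hHr s i) (hHr s o))
      have h6 := hr s
      have h7 : lam * Δ s / 8 * (m / 2) ≤ lam * Δ s / 8 * field F H (diag N s) o := by
        have := hΔ0 s
        gcongr
      linarith
    have h8 := abs_add_le (field F H X i / field F H X o -
      field F H (diag N s) i / field F H (diag N s) o - b s * (X i - s))
      (field F H (diag N s) i / field F H (diag N s) o - 1)
    have h9 : field F H X i / field F H X o - 1 - b s * (X i - s) = field F H X i / field F H X o -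
      field F H (diag N s) i / field F H (diag N s) o - b s * (X i - s) +
      (field F H (diag N s) i / field F H (diag N s) o - 1) := by ring
    rw [h9]
    rw [diag_apply] at h1
    have h10 : 0 < lam * Δ s := mul_pos hlam (hΔ0 s)
    nlinarith
  · have h1 := hΔη' X hX
    have h2 := hΔη' X' hX'
    rw [hVeq X h1, hVeq X' h2]
    exact hcon X X' hXX' (h1.trans (by linarith)) (h2.trans (by linarith)) i

end MeanField

namespace MeanField

variable {N : ℕ} {F : (Fin N → ℝ) → ℝ → ℝ} {H : (Fin N → ℝ) → (Fin N → ℝ)}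

/-- The contraction estimate for the perturbed field near the diagonal. -/
theorem field_contraction (hH : ContDiff ℝ 1 H) (o : Fin N) {m M ε η r lam : ℝ} (hm : 0 < m) (hM : 0 ≤ M)
    (hεm : ε ≤ m / 4) (hη : η ≤ 1 / 2) (hr0 : 0 ≤ r) (hrε : (N + 1) * r ≤ ε)
    (hlam : (4 / m + 8 * (M + m) / m ^ 2 + 2 * M / m ^ 2) * (2 * ε) ≤ lam / 2)
    (hfm : ∀ s, m ≤ F (diag N s) s) (hD : ∀ s, ‖diagDeriv F s‖ ≤ M)
    (hest : ∀ (s : ℝ) (p q : (Fin N → ℝ) × ℝ), ‖p - (diag N s, s)‖ ≤ η →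
      ‖q - (diag N s, s)‖ ≤ η → |F p.1 p.2 - F (diag N s) s| ≤ ε ∧
        |F p.1 p.2 - F q.1 q.2 - diagDeriv F s (p - q)| ≤ ε * ‖p - q‖)
    (hHr : ∀ X ∈ strip N, ∀ i, |H X i| ≤ r)
    (hHd : ∀ X ∈ strip N, ∀ i, ‖fderiv ℝ (fun X => H X i) X‖ ≤ N * r)
    {X X' : Fin N → ℝ} (hXX' : X o = X' o) (hX : ‖X - diag N (X o)‖ ≤ η)
    (hX' : ‖X' - diag N (X' o)‖ ≤ η) (i : Fin N) :
    |field F H X i / field F H X o - field F H X' i / field F H X' o -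
      transverseRate F (X o) * (X i - X' i)| ≤ lam / 2 * ‖X - X'‖ := by
  set s := X o
  rw [← hXX'] at hX'
  have hN0 : (0 : ℝ) ≤ N := N.cast_nonneg
  have hrε' : r ≤ ε := by nlinarith
  have hpt : ∀ Y : Fin N → ℝ, ‖Y - diag N s‖ ≤ η → ∀ j, ‖(Y, Y j) - (diag N s, s)‖ ≤ η :=
    fun Y hY j => max_le hY ((norm_le_pi_norm (Y - diag N s) j).trans hY)
  have hstrip : ∀ Y : Fin N → ℝ, ‖Y - diag N s‖ ≤ η → Y ∈ strip N := fun Y hY =>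
    closedBall_diag_subset_strip hη (mem_closedBall_iff_norm.2 hY)
  have hval : ∀ Y : Fin N → ℝ, ‖Y - diag N s‖ ≤ η → ∀ j,
      |field F H Y j - F (diag N s) s| ≤ 2 * ε := fun Y hY j => by
    have h1 := (hest s (Y, Y j) (Y, Y j) (hpt Y hY j) (hpt Y hY j)).1
    have h2 := hHr Y (hstrip Y hY) j
    have h3 : field F H Y j - F (diag N s) s = (F Y (Y j) - F (diag N s) s) + H Y j := by
      simp only [field]; ring
    rw [h3]
    refine (abs_add_le _ _).trans ?_
    simp only at h1
    linarith
  have hHlip : ∀ j, |H X j - H X' j| ≤ N * r * ‖X - X'‖ := fun j =>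
    (convex_closedBall (diag N s) η).norm_image_sub_le_of_norm_fderiv_le (𝕜 := ℝ)
      (f := fun X => H X j) (fun Y _ => (contDiff_pi.1 hH j).differentiable one_ne_zero Y)
      (fun Y hY => hHd Y (hstrip Y (mem_closedBall_iff_norm.1 hY)) j)
      (mem_closedBall_iff_norm.2 hX') (mem_closedBall_iff_norm.2 hX)
  set d := ‖X - X'‖
  have hd : 0 ≤ d := norm_nonneg _
  have hδ : ∀ j, |X j - X' j| ≤ d := fun j => norm_le_pi_norm (X - X') j
  have hdiff : ∀ j, |field F H X j - field F H X' j -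
      (diagDeriv F s (X - X', 0) + diagDeriv F s (0, 1) * (X j - X' j))| ≤ 2 * ε * d := fun j => by
    have h1 := (hest s (X, X j) (X', X' j) (hpt X hX j) (hpt X' hX' j)).2
    have h2 : diagDeriv F s ((X, X j) - (X', X' j)) =
        diagDeriv F s (X - X', 0) + diagDeriv F s (0, 1) * (X j - X' j) := by
      have h3 : ((X, X j) - (X', X' j) : (Fin N → ℝ) × ℝ)
          = (X - X', 0) + (X j - X' j) • ((0 : Fin N → ℝ), (1 : ℝ)) := by
        ext <;> simp
      rw [h3, map_add, map_smul, smul_eq_mul, mul_comm]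
    have h4 : ‖((X, X j) - (X', X' j) : (Fin N → ℝ) × ℝ)‖ ≤ d := max_le le_rfl (hδ j)
    rw [h2] at h1
    simp only at h1
    have h5 : field F H X j - field F H X' j -
      (diagDeriv F s (X - X', 0) + diagDeriv F s (0, 1) * (X j - X' j)) =
      (F X (X j) - F X' (X' j) -
        (diagDeriv F s (X - X', 0) + diagDeriv F s (0, 1) * (X j - X' j))) +
      (H X j - H X' j) := by simp only [field]; ring
    rw [h5]
    have h6 := hHlip j
    have h7 : ε * ‖((X, X j) - (X', X' j) : (Fin N → ℝ) × ℝ)‖ ≤ ε * d := by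
      have : 0 ≤ ε := hr0.trans hrε'
      gcongr
    have h8 : N * r * d ≤ ε * d := by
      have : N * r ≤ ε := by linarith
      gcongr
    exact (abs_add_le _ _).trans (by linarith)
  have hP : |diagDeriv F s (X - X', 0)| ≤ M * d := by
    refine ((diagDeriv F s).le_of_opNorm_le (hD s) _).trans ?_
    gcongr
    exact max_le le_rfl (by simp [hd])
  have ha : |diagDeriv F s (0, 1)| ≤ M := by
    refine ((diagDeriv F s).le_of_opNorm_le (hD s) _).trans ?_
    simp [Prod.norm_def]
  have hu := hdiff o
  -- Within a section the denominators change by the mean-field increment alone, the very term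
  -- shared by all numerators.
  rw [show X o - X' o = 0 from sub_eq_zero.2 hXX', mul_zero, add_zero] at hu
  have := abs_div_sub_div_sub_le hm hM hd (hfm s) (by linarith) hP (hδ i) ha (hdiff i) hu
    (hval X' hX' i) (hval X' hX' o) (hval X hX o)
  refine this.trans ?_
  gcongr

/-- Fields that agree on a forward invariant region have the same forward solutions there. -/
theorem isForwardSolution_iff_of_eqOn {t₀ : ℝ} {C : Set (Fin N → ℝ)} {V V' : (Fin N → ℝ) → Fin N → ℝ}
    (hV' : ContDiff ℝ 1 V') (heq : ∀ X ∈ C, V' X = V X)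
    (hex : ∀ X ∈ C, ∃ x : ℝ → Fin N → ℝ, x t₀ = X ∧ IsForwardSolution V t₀ x)
    (hinv : ∀ x : ℝ → Fin N → ℝ, IsForwardSolution V t₀ x → x t₀ ∈ C → ∀ t, t₀ ≤ t → x t ∈ C)
    {x : ℝ → Fin N → ℝ} (hx : x t₀ ∈ C) : IsForwardSolution V t₀ x ↔ IsForwardSolution V' t₀ x := by
  have h1 : ∀ y : ℝ → Fin N → ℝ, y t₀ ∈ C → IsForwardSolution V t₀ y →
      IsForwardSolution V' t₀ y := fun y hyC hy t ht => by
    have h2 := hy t ht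
    simp only [← heq _ (hinv y hy hyC t ht)] at h2
    exact h2
  refine ⟨h1 x hx, fun h => ?_⟩
  -- A solution for `V'` is not known in advance to stay in `C`; it is identified with the solution
  -- for `V`, which does stay.
  obtain ⟨y, hy0, hy⟩ := hex _ hx
  have hyx : Set.EqOn y x (Set.Ici t₀) :=
    eqOn_Ici_of_isIntegralCurveOn hV' (h1 y (hy0 ▸ hx) hy) h hy0
  intro t ht
  rw [← hyx ht]
  exact (hy t ht).congr (fun s hs => (hyx hs).symm) (hyx ht).symm

end MeanField

/-! ### The theorem: choice of constants and transfer to the original field. -/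

open MeanField

theorem mainTheorem2 (N : ℕ) (hN : 2 ≤ N) (t₀ : ℝ) (F : (Fin N → ℝ) → ℝ → ℝ)
    (hF : MeanField.HypH F) (hFstar : MeanField.HypHStar F) :
    ∃ Dstar : ℝ, 0 < Dstar ∧ ∀ D : ℝ, 0 < D → D ≤ Dstar →
      ∃ r : ℝ, 0 < r ∧ ∃ C : Set (Fin N → ℝ), MeanField.IsSyncRegion F t₀ D r C ∧
        ∀ H : (Fin N → ℝ) → (Fin N → ℝ), ContDiff ℝ 1 H → Function.Periodic H 1 →
          max (MeanField.stripNormVec H) (MeanField.stripNormDVec H) < ENNReal.ofReal r →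
          ∃ (W : Set (Fin N → ℝ)) (ρ : ℝ) (Ψ : ℝ → Fin N → ℝ),
            W ⊆ C ∧ MeanField.IsC1Submanifold (N - 1) W ∧
            0 < ρ ∧ ContDiff ℝ 1 Ψ ∧ Function.Periodic Ψ (1 / ρ) ∧
            MeanField.IsForwardSolution (MeanField.field F H) t₀ (MeanField.lockedOrbit ρ Ψ) ∧
            MeanField.lockedOrbit ρ Ψ t₀ ∈ W ∧
            (∃ β : ℝ, 0 < β ∧ ∃ K : ℝ, 0 < K ∧ ∀ x : ℝ → Fin N → ℝ,
              MeanField.IsForwardSolution (MeanField.field F H) t₀ x → x t₀ ∈ W →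
                ∀ t, t₀ ≤ t →
                  ‖x t - MeanField.lockedOrbit ρ Ψ t‖ < K * Real.exp (-β * (t - t₀))) ∧
            MeanField.IsOrbitallyAsymptoticallyStable (MeanField.field F H) t₀
              (Set.range (MeanField.lockedOrbit ρ Ψ)) := by
  set o : Fin N := ⟨0, by omega⟩
  have : Nonempty (Fin N) := ⟨o⟩
  have hF1 : ContDiff ℝ 1 (fun p : (Fin N → ℝ) × ℝ => F p.1 p.2) :=
    hF.contDiff_uncurry.of_le (by norm_num)
  obtain ⟨m, hm, M, hfm, hfM, hD, hbc, hbp, hest⟩ := hF.exists_estimates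
  have hM : 0 ≤ M := (abs_nonneg _).trans (hfM 0)
  have hbneg : ∫ s in (0 : ℝ)..1, transverseRate F s < 0 := by
    have h1 := hFstar
    simp only [HypHStar, hF.deriv_eq] at h1
    exact h1
  obtain ⟨lam, hlam, w, hw0, hwp, hwd, hwc⟩ := exists_periodic_weight hbc hbp hbneg
  obtain ⟨wmin, hwmin0, hwmin⟩ := hwp.exists_pos_le_of_continuous hwc.continuous fun s _ => hw0 s
  obtain ⟨wmax, hwmax⟩ := hwp.exists_norm_le_of_continuous hwc.continuous
  have hwmax' : ∀ s, w s ≤ wmax := fun s => (le_abs_self _).trans (hwmax s)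
  have hwmax0 : 0 < wmax := (hw0 0).trans_le (hwmax' 0)
  set c₁ := 4 / m + 8 * (M + m) / m ^ 2 + 2 * M / m ^ 2
  have hc₁ : 0 < c₁ := by positivity
  -- The three bounds serve, in order, positivity of the velocities near the diagonal, the
  -- test-particle estimate, and the section contraction, where `F` and `H` contribute `ε` each.
  set ε := min (m / 4) (min (lam * m / (8 * (1 + M / m))) (lam / (4 * c₁)))
  have hε : 0 < ε := by positivity
  have hε1 : ε ≤ m / 4 := min_le_left _ _
  have hε2 : ε * (1 + M / m) ≤ lam * m / 8 := by
    have h1 : ε ≤ lam * m / (8 * (1 + M / m)) := (min_le_right _ _).trans (min_le_left _ _)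
    calc _ ≤ lam * m / (8 * (1 + M / m)) * (1 + M / m) := by gcongr
      _ = _ := by field_simp
  have hε3 : c₁ * (2 * ε) ≤ lam / 2 := by
    have h1 : ε ≤ lam / (4 * c₁) := (min_le_right _ _).trans (min_le_right _ _)
    calc _ ≤ c₁ * (2 * (lam / (4 * c₁))) := by gcongr
      _ = _ := by field_simp; norm_num
  obtain ⟨η₀, hη₀, hest⟩ := hest ε hε
  set η := min η₀ (1 / 2)
  have hη : 0 < η := by positivity
  have hη1 : η ≤ 1 / 2 := min_le_right _ _
  have hest : ∀ (s : ℝ) (p q : (Fin N → ℝ) × ℝ), ‖p - (diag N s, s)‖ ≤ η →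
      ‖q - (diag N s, s)‖ ≤ η → |F p.1 p.2 - F (diag N s) s| ≤ ε ∧
        |F p.1 p.2 - F q.1 q.2 - diagDeriv F s (p - q)| ≤ ε * ‖p - q‖ := fun s p q hp hq =>
    hest s p q (hp.trans (min_le_left _ _)) (hq.trans (min_le_left _ _))
  have hpt : ∀ s X, ‖X - diag N s‖ ≤ η → ‖(X, s) - (diag N s, s)‖ ≤ η := fun s X hX =>
    max_le hX (by simp [hη.le])
  have hpt' : ∀ s X, ‖X - diag N s‖ ≤ η → ∀ i, ‖(X, X i) - (diag N s, s)‖ ≤ η :=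
    fun s X hX i => max_le hX ((norm_le_pi_norm (X - diag N s) i).trans hX)
  have hFv : ∀ s X, ‖X - diag N s‖ ≤ η → |F X s - F (diag N s) s| ≤ ε := fun s X hX =>
    (hest s (X, s) (X, s) (hpt s X hX) (hpt s X hX)).1
  have hFv' : ∀ s X, ‖X - diag N s‖ ≤ η → ∀ i, |F X (X i) - F (diag N s) s| ≤ ε :=
    fun s X hX i => (hest s (X, X i) (X, s) (hpt' s X hX i) (hpt s X hX)).1
  have hub : ∀ {s y : ℝ}, |y - F (diag N s) s| ≤ ε → |y| ≤ M + ε := fun {s y} hy => by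
    have := abs_add_le (y - F (diag N s) s) (F (diag N s) s)
    rw [sub_add_cancel] at this
    linarith [hfM s]
  have hlb : ∀ {s y : ℝ}, |y - F (diag N s) s| ≤ ε → 3 * m / 4 ≤ y := fun {s y} hy => by
    linarith [(abs_le.1 hy).1, hfm s]
  have hestb : ∀ s X, ‖X - diag N s‖ ≤ η → ∀ i,
      |F X (X i) - F X s - transverseRate F s * F X s * (X i - s)|
        ≤ lam * m / 8 * ‖X - diag N s‖ := by
    intro s X hX i
    have h1 := (hest s (X, X i) (X, s) (hpt' s X hX i) (hpt s X hX)).2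
    have h2 : ((X, X i) - (X, s) : (Fin N → ℝ) × ℝ) = (X i - s) • ((0 : Fin N → ℝ), (1 : ℝ)) := by
      ext <;> simp
    have h3 : ‖((0 : Fin N → ℝ), (1 : ℝ))‖ = 1 := by simp [Prod.norm_def]
    rw [h2, map_smul, smul_eq_mul, norm_smul, h3, mul_one, Real.norm_eq_abs] at h1
    simp only at h1
    have h4 : |X i - s| ≤ ‖X - diag N s‖ := norm_le_pi_norm (X - diag N s) i
    have hfpos : 0 < F (diag N s) s := hm.trans_le (hfm s)
    have h5 : |diagDeriv F s (0, 1)| ≤ M := by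
      have := (diagDeriv F s).le_of_opNorm_le (hD s) (0, 1)
      rwa [h3, mul_one] at this
    have h6 : |transverseRate F s| ≤ M / m := by
      rw [transverseRate, abs_div, abs_of_pos hfpos]
      exact div_le_div₀ hM h5 hm (hfm s)
    have h7 : F X (X i) - F X s - transverseRate F s * F X s * (X i - s) =
        (F X (X i) - F X s - (X i - s) * diagDeriv F s (0, 1)) -
          transverseRate F s * (F X s - F (diag N s) s) * (X i - s) := by
      rw [transverseRate]; field_simp; ring
    rw [h7]
    refine (abs_sub _ _).trans ?_
    rw [abs_mul, abs_mul]
    have h8 := hFv s X hX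
    calc _ ≤ ε * |X i - s| + M / m * ε * |X i - s| := by gcongr
      _ = ε * (1 + M / m) * |X i - s| := by ring
      _ ≤ _ := by gcongr
  -- Coordinates of a point of the tube differ by at most `2 * D ≤ η / 2`, the radius within which
  -- the cut-off field is the original one.
  refine ⟨η / 4, by positivity, fun D hD0 hDη => ?_⟩
  set Δ : ℝ → ℝ := fun s => D / wmax * w s
  have hΔ0 : ∀ s, 0 < Δ s := fun s => mul_pos (div_pos hD0 hwmax0) (hw0 s)
  have hΔD : ∀ s, Δ s ≤ D := fun s => by
    calc D / wmax * w s ≤ D / wmax * wmax := by have := hwmax' s; gcongr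
      _ = D := by field_simp
  have hΔc : ContDiff ℝ 1 Δ := contDiff_const.mul hwc
  have hΔp : Function.Periodic Δ 1 := fun s => by simp only [Δ, hwp s]
  have hΔd : ∀ s, HasDerivAt Δ (Δ s * (transverseRate F s + lam)) s := fun s =>
    ((hwd s).const_mul (D / wmax)).congr_deriv (by simp only [Δ]; ring)
  set δ := D / wmax * wmin
  have hδ0 : 0 < δ := by positivity
  have hδ : ∀ s, δ ≤ Δ s := fun s => by
    have := hwmin s
    simp only [δ, Δ]
    gcongr
  -- In order: positive velocities, the barrier on the tube boundary, and `(N + 1) * r ≤ ε`, where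
  -- `N * r` bounds the derivative of a component of `H` through its `N` partials.
  set r := min (m / 4) (min (lam * m * δ / 32) (ε / (N + 1)))
  have hr0 : 0 < r := by positivity
  have hr1 : r ≤ m / 4 := min_le_left _ _
  have hr2 : ∀ s, r ≤ lam * m * Δ s / 32 := fun s => by
    calc r ≤ lam * m * δ / 32 := (min_le_right _ _).trans (min_le_left _ _)
      _ ≤ _ := by have := hδ s; gcongr
  have hr3 : (N + 1) * r ≤ ε := by
    have h1 : r ≤ ε / (N + 1) := (min_le_right _ _).trans (min_le_right _ _)
    rw [le_div_iff₀ (by positivity)] at h1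
    linarith
  have hsync : IsSyncRegion F t₀ D r (tube N Δ) :=
    isSyncRegion_tube hF1 hlam hη hη1 hm hΔ0 hΔD (by linarith) hΔc hΔp hΔd
      (fun s X hX => ⟨hub (hFv s X hX), fun i => hub (hFv' s X hX i)⟩)
      (fun s X hX => ⟨by linarith [hlb (hFv s X hX)], fun i => by linarith [hlb (hFv' s X hX i)]⟩)
      hestb (fun s => (hr2 s).trans (by have := mul_pos (mul_pos hlam hm) (hΔ0 s); linarith)) hr1 t₀
  refine ⟨r, hr0, tube N Δ, hsync, fun H hH hHp hHr => ?_⟩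
  have hHr1 := (le_max_left _ _).trans_lt hHr
  have hHr2 := (le_max_right _ _).trans_lt hHr
  have hHs : ∀ X ∈ strip N, ∀ i, |H X i| ≤ r := fun X hX i => (norm_le_of_stripNormVec_lt hHr1 hX i).le
  have hstrip : ∀ s X, ‖X - diag N s‖ ≤ η → X ∈ strip N := fun s X hX =>
    closedBall_diag_subset_strip hη1 (mem_closedBall_iff_norm.2 hX)
  obtain ⟨V, MV, LV, hV, hVeq⟩ := exists_contractingField hF hH hHp o hlam hη hm hΔ0
    (fun s => (hΔD s).trans (by linarith)) hΔp hΔd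
    (fun s X hX => by
      have h1 := hlb (hFv' s X hX o)
      have h2 := (abs_le.1 (hHs X (hstrip s X hX) o)).1
      simp only [field]
      linarith)
    (fun s i => hHs _ (hstrip s _ (by simp [hη.le])) i) hr2
    (fun X X' hXX' hX hX' i => field_contraction hH o hm hM hε1 hη1 hr0.le hr3
      hε3 hfm hD hest hHs (fun X hX i => norm_fderiv_le_of_stripNormDVec_lt hHr2 hX i)
      hXX' hX hX' i)
  have hsub : sectionTube o Δ ⊆ tube N Δ := fun X hX => (mem_tube_iff hΔ0).2 ⟨X o, hX⟩
  -- Agreement is needed on the whole tube, which contains `sectionTube o Δ`, since the forward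
  -- invariance in `hsync` is that of the tube.
  have heq : ∀ X ∈ tube N Δ, V X = field F H X := fun X hX => by
    obtain ⟨ν, hν⟩ := (mem_tube_iff hΔ0).1 hX
    refine hVeq X ?_
    have h1 : ∀ i, |X i - ν| ≤ D := fun i =>
      (norm_le_pi_norm (X - diag N ν) i).trans (hν.le.trans (hΔD ν))
    refine (pi_norm_le_iff_of_nonneg (by positivity)).2 fun i => ?_
    have h2 := abs_sub_le (X i) ν (X o)
    rw [abs_sub_comm ν] at h2
    have h3 : |X i - X o| ≤ η / 2 := by linarith [h1 i, h1 o]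
    exact h3
  have hiff : ∀ {x : ℝ → Fin N → ℝ}, x t₀ ∈ tube N Δ →
      (IsForwardSolution (field F H) t₀ x ↔ IsForwardSolution V t₀ x) := fun hx =>
    isForwardSolution_iff_of_eqOn hV.contDiff heq (hsync.existence H hH hHr1)
      (fun x hx hxC => (hsync.synchronization H hH hHr1 x hx hxC).1) hx
  obtain ⟨W, ρ, Ψ, hWsub, hWman, hρ, hΨ, hΨp, hsol, hW0, ⟨β, hβ, K, hK, hatt⟩, ⟨δ₁, hδ₁, hnear⟩,
    ⟨⟨δ₂, hδ₂, -, hconv⟩, hstab⟩⟩ := hV.exists_lockedOrbit t₀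
  have hWC : W ⊆ tube N Δ := hWsub.trans hsub
  refine ⟨W, ρ, Ψ, hWC, hWman, hρ, hΨ, hΨp, (hiff (hWC hW0)).2 hsol, hW0,
    ⟨β, hβ, K, hK, fun x hx hxW => hatt x ((hiff (hWC hxW)).1 hx) hxW⟩,
    ⟨min δ₁ δ₂, lt_min hδ₁ hδ₂, fun X hX => ?_, fun x hx hxd => ?_⟩, fun ε' hε' => ?_⟩
  · exact hsync.existence H hH hHr1 X (hsub (hnear X (hX.trans_le (min_le_left _ _))))
  · have hxC := hsub (hnear _ (hxd.trans_le (min_le_left _ _)))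
    exact hconv x ((hiff hxC).1 hx) (hxd.trans_le (min_le_right _ _))
  · obtain ⟨δ₃, hδ₃, h3⟩ := hstab ε' hε'
    refine ⟨min δ₁ δ₃, lt_min hδ₁ hδ₃, fun x hx hxd => ?_⟩
    have hxC := hsub (hnear _ (hxd.trans_le (min_le_left _ _)))
    exact h3 x ((hiff hxC).1 hx) (hxd.trans_le (min_le_right _ _))
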